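/- Consider the problem Steiner Forest: given a finite (unweighted, undirected, simple) graph $G$, a set $S\subseteq V(G)\times V(G)$ of terminal pairs and an integer $\ell\ge 0$, decide whether $(G,S)$ has a Steiner forest $F$ with $|E(F)|\le \ell$. Here a Steiner forest of $(G,S)$ is a subgraph $F$ of $G$ such that for every $(s,t)\in S$ the vertices $s$ and $t$ belong to the same connected component of $F$. Theorem. Steiner Forest is fixed-parameter tractable when parameterized by the vertex cover number $k$ of the input graph (neither $k$ nor a vertex cover is given as part of the input). More precisely, Steiner Forest can be decided in time $2^{O(k\log k)}\, n^{O(1)}$, where $n=|V(G)|$; and, given $(G,S)$, one can also compute in time $2^{O(k\log k)}\, n^{O(1)}$ a Steiner forest of $(G,S)$ with the minimum number of edges, or report that $(G,S)$ has no Steiner forest. (Running times count the steps of a random access machine with addition and subtraction; $n^{O(1)}$ means at most $c\,(n+1)^c$ for a constant $c$.) -/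

import Mathlib

/-! ### A random access machine with step count

Programs are structured (`while`) programs over finitely many registers and finitely many unbounded
arrays of natural numbers, with indirect addressing into the arrays.  The only arithmetic is
addition and truncated subtraction, so that `t` steps lengthen the binary representations of the
numbers by at most `t` bits beyond those of the input and of the constants of the program, and the
unit-cost measure below is polynomially related to Turing machine time. -/

namespace RAM

/-- A machine state: the registers and the arrays.  Every program mentions only finitely many
registers and arrays, since neither can be addressed indirectly (array cells can). -/
structure State where
  reg : ℕ → ℕ
  arr : ℕ → ℕ → ℕ

/-- Arithmetic expressions. -/
inductive Expr where
  /-- a constant -/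
  | lit (a : ℕ) : Expr
  /-- the content of a register -/
  | reg (x : ℕ) : Expr
  /-- addition -/
  | add (e f : Expr) : Expr
  /-- truncated subtraction -/
  | sub (e f : Expr) : Expr
  /-- the content of the cell of array `a` whose index is the value of `e` -/
  | read (a : ℕ) (e : Expr) : Expr

/-- The value of an expression. -/
def Expr.eval (s : State) : Expr → ℕ
  | .lit a => a
  | .reg x => s.reg x
  | .add e f => e.eval s + f.eval s
  | .sub e f => e.eval s - f.eval s
  | .read a e => s.arr a (e.eval s)

/-- The number of steps needed to evaluate an expression: one for each symbol. -/
def Expr.cost : Expr → ℕ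
  | .lit _ => 1
  | .reg _ => 1
  | .add e f => e.cost + f.cost + 1
  | .sub e f => e.cost + f.cost + 1
  | .read _ e => e.cost + 1

/-- Programs. -/
inductive Prog where
  /-- do nothing -/
  | skip : Prog
  /-- store the value of `e` in register `x` -/
  | assign (x : ℕ) (e : Expr) : Prog
  /-- store the value of `e` in the cell of array `a` whose index is the value of `i` -/
  | write (a : ℕ) (i e : Expr) : Prog
  /-- run `p`, then `q` -/
  | seq (p q : Prog) : Prog
  /-- run `p` if the value of `e` is nonzero, and `q` otherwise -/
  | ite (e : Expr) (p q : Prog) : Prog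
  /-- run `p` as long as the value of `e` is nonzero -/
  | loop (e : Expr) (p : Prog) : Prog

/-- The state after storing `v` in register `x`. -/
def State.setReg (s : State) (x v : ℕ) : State :=
  { s with reg := Function.update s.reg x v }

/-- The state after storing `v` in cell `i` of array `a`. -/
def State.setArr (s : State) (a i v : ℕ) : State :=
  { s with arr := Function.update s.arr a (Function.update (s.arr a) i v) }

/-- `Exec p s s' t`: started in state `s`, the program `p` halts in state `s'` after exactly `t`
steps. -/
inductive Exec : Prog → State → State → ℕ → Prop
  | skip (s : State) : Exec .skip s s 1
  | assign (s : State) (x : ℕ) (e : Expr) :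
      Exec (.assign x e) s (s.setReg x (e.eval s)) (e.cost + 1)
  | write (s : State) (a : ℕ) (i e : Expr) :
      Exec (.write a i e) s (s.setArr a (i.eval s) (e.eval s)) (i.cost + e.cost + 1)
  | seq {p q : Prog} {s s₁ s₂ : State} {t₁ t₂ : ℕ} :
      Exec p s s₁ t₁ → Exec q s₁ s₂ t₂ → Exec (.seq p q) s s₂ (t₁ + t₂)
  | iteTrue {e : Expr} {p q : Prog} {s s₁ : State} {t : ℕ} :
      e.eval s ≠ 0 → Exec p s s₁ t → Exec (.ite e p q) s s₁ (e.cost + 1 + t)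
  | iteFalse {e : Expr} {p q : Prog} {s s₁ : State} {t : ℕ} :
      e.eval s = 0 → Exec q s s₁ t → Exec (.ite e p q) s s₁ (e.cost + 1 + t)
  | loopTrue {e : Expr} {p : Prog} {s s₁ s₂ : State} {t₁ t₂ : ℕ} :
      e.eval s ≠ 0 → Exec p s s₁ t₁ → Exec (.loop e p) s₁ s₂ t₂ →
      Exec (.loop e p) s s₂ (e.cost + 1 + t₁ + t₂)
  | loopFalse {e : Expr} {p : Prog} {s : State} :
      e.eval s = 0 → Exec (.loop e p) s s (e.cost + 1)

/-- The initial state on input `x`: register `0` holds the length of `x`, array `0` holds `x`, and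
everything else is `0`. -/
def State.init (x : List ℕ) : State where
  reg := fun r => if r = 0 then x.length else 0
  arr := fun a i => if a = 0 then x.getD i 0 else 0

/-- The output of a halted machine: the first `m` cells of array `1`, where `m` is the content of
register `0`. -/
def State.output (s : State) : List ℕ :=
  (List.range (s.reg 0)).map (s.arr 1)

/-- On input `x` the program `P` halts after at most `T` steps, with output `y`. -/
def Prog.OutputsWithin (P : Prog) (x y : List ℕ) (T : ℝ) : Prop :=
  ∃ (s : State) (t : ℕ), Exec P (State.init x) s t ∧ s.output = y ∧ (t : ℝ) ≤ T

open Classical in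
/-- On input `x` the program `P` halts after at most `T` steps and answers the yes-no question `Q`,
with output `1` for yes and output `0` for no. -/
def Prog.DecidesWithin (P : Prog) (x : List ℕ) (Q : Prop) (T : ℝ) : Prop :=
  P.OutputsWithin x [if Q then 1 else 0] T

/-- The size of an input: the number of its binary digits, plus one for every entry. -/
def inputSize (x : List ℕ) : ℕ :=
  (x.map fun a => a.size + 1).sum

/-- The decision problem `Q` on instances of type `α`, encoded by `enc`, is fixed-parameter tractable
by the parameter `κ`: one program answers every instance `a` within `f (κ a) * |a| ^ c` steps, where
`f` is computable and `c` is a constant.  The parameter is not part of the input. -/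
def FixedParameterTractable {α : Type} (enc : α → List ℕ) (Q : α → Prop) (κ : α → ℕ) : Prop :=
  ∃ (f : ℕ → ℕ) (c : ℕ) (P : Prog), Computable f ∧
    ∀ a : α, P.DecidesWithin (enc a) (Q a) ((f (κ a) : ℝ) * (inputSize (enc a) : ℝ) ^ c)

end RAM

/-! ### Steiner forests -/

/-- `F` is a Steiner forest of `G` for the set `S` of terminal pairs: a subgraph of `G` in which the
two members of every pair belong to the same connected component.  (Acyclicity is not part of the
definition; a Steiner forest with the minimum number of edges has no cycles.) -/
def IsSteinerForest {V : Type} {G : SimpleGraph V} (S : Set (V × V)) (F : G.Subgraph) : Prop :=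
  ∀ p ∈ S, ∃ (h₁ : p.1 ∈ F.verts) (h₂ : p.2 ∈ F.verts), F.coe.Reachable ⟨p.1, h₁⟩ ⟨p.2, h₂⟩

/-- `F` is a Steiner forest with the minimum number of edges. -/
def IsMinSteinerForest {V : Type} {G : SimpleGraph V} (S : Set (V × V)) (F : G.Subgraph) : Prop :=
  IsSteinerForest S F ∧
    ∀ F' : G.Subgraph, IsSteinerForest S F' → F.edgeSet.ncard ≤ F'.edgeSet.ncard

/-- A finite graph on the vertices `0, …, n - 1` with a set of terminal pairs. -/
structure SteinerInstance where
  n : ℕ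
  G : SimpleGraph (Fin n)
  S : Set (Fin n × Fin n)

namespace SteinerInstance

/-- `(G, S)` has a Steiner forest with at most `l` edges. -/
def HasSteinerForestOfSize (I : SteinerInstance) (l : ℕ) : Prop :=
  ∃ F : I.G.Subgraph, IsSteinerForest I.S F ∧ F.edgeSet.ncard ≤ l

/-- `(G, S)` has a Steiner forest. -/
def Feasible (I : SteinerInstance) : Prop :=
  ∃ F : I.G.Subgraph, IsSteinerForest I.S F

/-- The vertex cover number of the graph (which is finite). -/
noncomputable def vc (I : SteinerInstance) : ℕ :=
  I.G.vertexCoverNum.toNat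

end SteinerInstance

open Classical in
/-- The `0`-`1` matrix of a binary relation on `0, …, n - 1`, row by row. -/
noncomputable def matrixBits {n : ℕ} (r : Fin n → Fin n → Prop) : List ℕ :=
  (List.finRange n).flatMap fun i => (List.finRange n).map fun j => if r i j then 1 else 0

/-- The encoding of `(G, S)`: the number of vertices, the adjacency matrix of `G`, and the matrix
of `S`. -/
noncomputable def SteinerInstance.encode (I : SteinerInstance) : List ℕ :=
  I.n :: (matrixBits I.G.Adj ++ matrixBits fun u v => (u, v) ∈ I.S)

/-- The encoding of `(G, S, l)`: the integer `l`, followed by the encoding of `(G, S)`. -/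
noncomputable def SteinerInstance.encodeWith (I : SteinerInstance) (l : ℕ) : List ℕ :=
  l :: I.encode

/-!
Let `C` be the set of ends of a greedily found maximal matching, a vertex cover with `m ≤ 2 * k`
members.  There are at most `(m + 1) ^ m = 2 ^ O(k log k)` maps of `C` into itself and subsets of
`C`, so a property is decided within the time bound if it is expressed with a bounded number of
quantifiers over vertices, such maps and such subsets.

The existence of a Steiner forest with at most `l` edges can be expressed in this way.  Root the
forest, in `C` wherever possible, and record its trace on `C`: the root of every `i ∈ C`, the next
ancestor of `i` in `C`, and which members of `C` have their parents outside of `C` in the same class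
of terminals.  Conversely, a trace extends to a forest if every class of terminals fits into some
component, and if pairwise different classes can be chosen to supply the parents outside of `C`.
By Hall's theorem the latter is a condition on the subsets of `C`, and so is the absence of cycles.
The number of edges is the number of vertices that are not roots, which the trace determines.

A minimum Steiner forest is found by self-reduction: edges are deleted as long as a forest with the
optimal number of edges remains.
-/

namespace RAM

/-! ### Program logic -/

/-- The Hoare triple of the machine with a time bound: started in `s`, the program `p` halts after
at most `T` steps in a state that satisfies `Q`. -/
def Prog.EndsWithin (p : Prog) (s : State) (T : ℕ) (Q : State → Prop) : Prop :=
  ∃ s' t, Exec p s s' t ∧ t ≤ T ∧ Q s'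

namespace Prog.EndsWithin

variable {p q : Prog} {s : State} {T T' : ℕ} {Q Q' R : State → Prop}

theorem mono (h : p.EndsWithin s T Q) (hT : T ≤ T') (hQ : ∀ s', Q s' → Q' s') :
    p.EndsWithin s T' Q' := by
  obtain ⟨s', t, h, ht, hs⟩ := h
  exact ⟨s', t, h, ht.trans hT, hQ s' hs⟩

theorem assign {x : ℕ} {e : Expr} (h : Q (s.setReg x (e.eval s))) :
    (Prog.assign x e).EndsWithin s (e.cost + 1) Q :=
  ⟨_, _, .assign s x e, le_rfl, h⟩

theorem write {a : ℕ} {i e : Expr} (h : Q (s.setArr a (i.eval s) (e.eval s))) :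
    (Prog.write a i e).EndsWithin s (i.cost + e.cost + 1) Q :=
  ⟨_, _, .write s a i e, le_rfl, h⟩

theorem seq (hp : p.EndsWithin s T R) (hq : ∀ s', R s' → q.EndsWithin s' T' Q) :
    (Prog.seq p q).EndsWithin s (T + T') Q := by
  obtain ⟨s₁, t₁, h₁, ht₁, hs₁⟩ := hp
  obtain ⟨s₂, t₂, h₂, ht₂, hs₂⟩ := hq s₁ hs₁
  exact ⟨s₂, _, h₁.seq h₂, add_le_add ht₁ ht₂, hs₂⟩

theorem ite {e : Expr} (hp : e.eval s ≠ 0 → p.EndsWithin s T Q)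
    (hq : e.eval s = 0 → q.EndsWithin s T' Q) :
    (Prog.ite e p q).EndsWithin s (e.cost + 1 + (T + T')) Q := by
  by_cases he : e.eval s = 0
  · obtain ⟨s', t, h, ht, hs⟩ := hq he
    exact ⟨s', _, .iteFalse he h, by lia, hs⟩
  · obtain ⟨s', t, h, ht, hs⟩ := hp he
    exact ⟨s', _, .iteTrue he h, by lia, hs⟩

end Prog.EndsWithin

/-- Run `p` with register `x` counting from `0` up to the content of register `y`. -/
def Prog.countLoop (x y : ℕ) (p : Prog) : Prog :=
  .seq (.assign x (.lit 0)) <| .loop (.sub (.reg y) (.reg x)) <|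
    .seq p (.assign x (.add (.reg x) (.lit 1)))

theorem Prog.EndsWithin.countLoop {x y len T : ℕ} {p : Prog} {s : State} (hxy : x ≠ y)
    (Inv : ℕ → State → Prop) (hlen : s.reg y = len) (init : Inv 0 (s.setReg x 0))
    (step : ∀ i < len, ∀ s, Inv i s → s.reg x = i →
      p.EndsWithin s T fun s' => Inv (i + 1) (s'.setReg x (i + 1)) ∧
        s'.reg x = s.reg x ∧ s'.reg y = s.reg y) :
    (Prog.countLoop x y p).EndsWithin s (len * (T + 8) + 6) (Inv len) := by
  have loop : ∀ k i s, i + k = len → Inv i s → s.reg x = i → s.reg y = len →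
      (Prog.loop (.sub (.reg y) (.reg x)) <| .seq p (.assign x (.add (.reg x) (.lit 1)))).EndsWithin
        s (k * (T + 8) + 4) (Inv len) := by
    intro k
    induction k with
    | zero =>
      intro i s hi hInv hx hy
      obtain rfl : i = len := by lia
      exact ⟨s, _, .loopFalse (by simp [Expr.eval, hx, hy]), by simp [Expr.cost], hInv⟩
    | succ k ih =>
      intro i s hi hInv hx hy
      obtain ⟨s₁, t₁, h₁, ht₁, hInv₁, hx₁, hy₁⟩ := step i (by lia) s hInv hx
      obtain ⟨s₂, t₂, h₂, ht₂, hs₂⟩ := ih (i + 1) (s₁.setReg x (i + 1)) (by lia) hInv₁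
        (by simp [State.setReg]) (by simp [State.setReg, hxy.symm, hy₁, hy])
      have hinc : s₁.setReg x (i + 1) =
          s₁.setReg x ((Expr.add (.reg x) (.lit 1)).eval s₁) := by simp [Expr.eval, hx₁, hx]
      refine ⟨s₂, _, .loopTrue (by simp only [Expr.eval]; lia)
        (h₁.seq (.assign _ _ _)) (hinc ▸ h₂), ?_, hs₂⟩
      simp only [Expr.cost]
      lia
  refine (seq (T := 2) (T' := len * (T + 8) + 4) (.assign (Q := fun s' => s' = s.setReg x 0) rfl)
    ?_).mono (by lia) fun _ h => h
  rintro _ rfl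
  exact loop len 0 _ (by lia) init (by simp [State.setReg]) (by simp [State.setReg, hxy.symm, hlen])

/-- A function bounded by a polynomial. -/
def PolyBounded (f : ℕ → ℕ) : Prop :=
  ∃ k, ∀ X, f X ≤ k * (X + 1) ^ k

namespace PolyBounded

variable {f g : ℕ → ℕ}

theorem const (a : ℕ) : PolyBounded fun _ => a :=
  ⟨a, fun X => Nat.le_mul_of_pos_right _ (by positivity)⟩

theorem id : PolyBounded fun X => X := ⟨1, fun X => by simp⟩

theorem add (hf : PolyBounded f) (hg : PolyBounded g) : PolyBounded fun X => f X + g X := by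
  obtain ⟨k, hk⟩ := hf
  obtain ⟨l, hl⟩ := hg
  refine ⟨k + l, fun X => ?_⟩
  calc f X + g X ≤ k * (X + 1) ^ k + l * (X + 1) ^ l := add_le_add (hk X) (hl X)
    _ ≤ k * (X + 1) ^ (k + l) + l * (X + 1) ^ (k + l) := by gcongr <;> lia
    _ = _ := by ring

theorem mul (hf : PolyBounded f) (hg : PolyBounded g) : PolyBounded fun X => f X * g X := by
  obtain ⟨k, hk⟩ := hf
  obtain ⟨l, hl⟩ := hg
  refine ⟨k * l + k + l, fun X => ?_⟩
  calc f X * g X ≤ (k * (X + 1) ^ k) * (l * (X + 1) ^ l) := Nat.mul_le_mul (hk X) (hl X)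
    _ = k * l * (X + 1) ^ (k + l) := by ring
    _ ≤ (k * l + k + l) * (X + 1) ^ (k * l + k + l) := by gcongr <;> lia

end PolyBounded

/-! ### Polynomial-time functions of the memory -/

/-- The contents of the arrays.  All data that outlive a single evaluation are kept in arrays, and
registers serve as temporary storage only.  Array `0` holds the input, array `1` the output, array
`8` temporary values, array `9` the length of the output, and array `10` the number of edges of an
optimal forest; arrays `2` to `7` hold the data described below. -/
abbrev Memory := ℕ → ℕ → ℕ

namespace Memory

variable (A : Memory)

/-- The number of vertices, the range of loops over vertices.  It is kept in array `2`. -/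
def order : ℕ := A 2 0

/-- The range of loops over maps of a vertex cover into itself, see `mapOfCode`.  It is kept in
array `3`. -/
def numCodes : ℕ := A 3 0

/-- The measure of running times: loops have a range of at most this length. -/
def size : ℕ := A.order + A.numCodes

/-- The memory after storing `v` in cell `i` of array `a`. -/
def set (a i v : ℕ) : Memory :=
  Function.update A a (Function.update (A a) i v)

variable {A}

theorem set_apply (a i v b j : ℕ) : A.set a i v b j = if b = a ∧ j = i then v else A b j := by
  by_cases h : b = a
  · subst h
    simp [set, Function.update_apply]
  · simp [set, h]

theorem set_apply_of_ne {a b : ℕ} (h : b ≠ a) (i v : ℕ) : A.set a i v b = A b := by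
  simp [set, h]

theorem order_set {a : ℕ} (h : a ≠ 2) (i v : ℕ) : (A.set a i v).order = A.order := by
  simp [order, set_apply_of_ne h.symm]

theorem numCodes_set {a : ℕ} (h : a ≠ 3) (i v : ℕ) : (A.set a i v).numCodes = A.numCodes := by
  simp [numCodes, set_apply_of_ne h.symm]

end Memory

/-- Tuples of bound variables: `Unit`, `Unit × ℕ`, `(Unit × ℕ) × ℕ`, … -/
class VarTuple (V : Type) where
  /-- the values of the variables, the innermost first -/
  values : V → List ℕ

instance : VarTuple Unit := ⟨fun _ => []⟩

instance {V : Type} [VarTuple V] : VarTuple (V × ℕ) := ⟨fun v => v.2 :: VarTuple.values v.1⟩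

/-- No value of a variable exceeds the size of the memory. -/
def VarTuple.InRange {V : Type} [VarTuple V] (v : V) (A : Memory) : Prop :=
  ∀ x ∈ values v, x ≤ A.size

/-- The state `s` stores the variables `v`, which are in range, in the registers `xs`. -/
def State.Stores {V : Type} [VarTuple V] (s : State) (xs : List ℕ) (v : V) : Prop :=
  xs.map s.reg = VarTuple.values v ∧ VarTuple.InRange v s.arr

/-- The states `s` and `s'` have the same registers below `d`. -/
def State.AgreesBelow (d : ℕ) (s' s : State) : Prop :=
  ∀ r < d, s'.reg r = s.reg r

section PolyTime

variable {V : Type} [VarTuple V]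

theorem State.Stores.congr {s s' : State} {xs : List ℕ} {v : V} {d : ℕ} (h : s.Stores xs v)
    (hxs : ∀ x ∈ xs, x < d) (hr : s'.AgreesBelow d s)
    (hA : Memory.size s'.arr = Memory.size s.arr) : s'.Stores xs v :=
  ⟨h.1 ▸ List.map_congr_left fun x hx => hr x (hxs x hx), fun x hx => hA ▸ h.2 x hx⟩

theorem State.Stores.cons {s : State} {xs : List ℕ} {v : V} {x i : ℕ} (h : s.Stores xs v)
    (hx : s.reg x = i) (hi : i ≤ Memory.size s.arr) : s.Stores (x :: xs) (v, i) := by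
  refine ⟨by simp [VarTuple.values, hx, h.1], ?_⟩
  simpa [VarTuple.InRange, VarTuple.values, hi] using h.2

/-- The program `p` stores `f v` in register `d`, if the variables `v` are stored in the registers
`xs`.  It is free to use the registers above `d`. -/
def Prog.Evaluates (p : Prog) (f : V → Memory → ℕ) (xs : List ℕ) (d : ℕ) (T : ℕ → ℕ) : Prop :=
  ∀ (v : V) (s : State), s.Stores xs v → p.EndsWithin s (T (Memory.size s.arr)) fun s' =>
    s'.arr = s.arr ∧ s'.AgreesBelow d s ∧ s'.reg d = f v s.arr

/-- `f` is computed in time polynomial in the size of the memory, whatever registers hold the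
variables and whatever register is to receive the value. -/
def PolyTime (f : V → Memory → ℕ) : Prop :=
  ∃ T, PolyBounded T ∧ ∀ (d : ℕ) (xs : List ℕ), (∀ x ∈ xs, x < d) →
    ∃ p : Prog, p.Evaluates f xs d T

/-- The predicate `P` is decided in time polynomial in the size of the memory. -/
def PolyTimePred (P : V → Memory → Prop) : Prop :=
  ∃ f : V → Memory → ℕ, PolyTime f ∧ ∀ v A, P v A ↔ f v A ≠ 0

/-- `len` can serve as the range of a loop. -/
def LoopRange (len : V → Memory → ℕ) : Prop :=
  PolyTime len ∧ ∀ v A, VarTuple.InRange v A → len v A ≤ A.size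

/-- The program `p` transforms the memory by `F v`, if the variables `v` are stored in the registers
`xs`.  It is free to use the registers from `d` on. -/
def Prog.Transforms (p : Prog) (F : V → Memory → Memory) (xs : List ℕ) (d : ℕ) (T : ℕ → ℕ) : Prop :=
  ∀ (v : V) (s : State), s.Stores xs v → p.EndsWithin s (T (Memory.size s.arr)) fun s' =>
    s'.arr = F v s.arr ∧ s'.AgreesBelow d s

/-- `F` preserves the size of the memory, and is carried out in time polynomial in this size. -/
def PolyTimeMap (F : V → Memory → Memory) : Prop :=
  (∀ v A, (F v A).size = A.size) ∧
    ∃ T, PolyBounded T ∧ ∀ (d : ℕ) (xs : List ℕ), (∀ x ∈ xs, x < d) →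
      ∃ p : Prog, p.Transforms F xs d T

theorem State.AgreesBelow.setReg {d x v : ℕ} {s' s : State} (h : s'.AgreesBelow d s) (hx : d ≤ x) :
    (s'.setReg x v).AgreesBelow d s := fun r hr => by
  simp [State.setReg, show r ≠ x by lia, h r hr]

theorem State.AgreesBelow.mono {d d' : ℕ} {s' s : State} (h : s'.AgreesBelow d' s) (hd : d ≤ d') :
    s'.AgreesBelow d s := fun r hr => h r (hr.trans_le hd)

theorem State.AgreesBelow.trans {d d' : ℕ} {s'' s' s : State} (h : s''.AgreesBelow d' s')
    (h' : s'.AgreesBelow d s) (hd : d ≤ d') : s''.AgreesBelow d s := fun r hr =>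
  (h r (hr.trans_le hd)).trans (h' r hr)

theorem State.AgreesBelow.refl {d : ℕ} {s : State} : s.AgreesBelow d s := fun _ _ => rfl

namespace PolyTime

variable {f g c : V → Memory → ℕ}

theorem const (a : ℕ) : PolyTime fun (_ : V) _ => a :=
  ⟨fun _ => 2, .const 2, fun d _ _ => ⟨.assign d (.lit a), fun _ _ _ =>
    .assign ⟨rfl, State.AgreesBelow.refl.setReg le_rfl, by simp [State.setReg, Expr.eval]⟩⟩⟩

theorem last : PolyTime fun (v : V × ℕ) _ => v.2 := by
  refine ⟨fun _ => 2, .const 2, fun d xs _ => ?_⟩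
  refine ⟨.assign d (.reg (xs.headD 0)), fun v s hv =>
    .assign ⟨rfl, State.AgreesBelow.refl.setReg le_rfl, ?_⟩⟩
  cases xs with
  | nil => simp [State.Stores, VarTuple.values] at hv
  | cons x xs =>
    have hx : s.reg x = v.2 := (List.cons_eq_cons.1 hv.1).1
    simp [State.setReg, Expr.eval, hx]

theorem weaken (hf : PolyTime f) : PolyTime fun (v : V × ℕ) A => f v.1 A := by
  obtain ⟨T, hT, hf⟩ := hf
  refine ⟨T, hT, fun d xs hxs => ?_⟩
  obtain ⟨p, hp⟩ := hf d xs.tail fun x hx => hxs x (List.mem_of_mem_tail hx)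
  refine ⟨p, fun v s hv => hp v.1 s ⟨?_, fun x hx => hv.2 x (List.mem_cons_of_mem _ hx)⟩⟩
  rw [List.map_tail, hv.1]
  rfl

theorem exists_evaluates_pair (hf : PolyTime f) (hg : PolyTime g) :
    ∃ T, PolyBounded T ∧ ∀ (d : ℕ) (xs : List ℕ), (∀ x ∈ xs, x < d) → ∃ p : Prog,
      ∀ (v : V) (s : State), s.Stores xs v → p.EndsWithin s (T (Memory.size s.arr)) fun s' =>
        s'.arr = s.arr ∧ s'.AgreesBelow d s ∧
          s'.reg d = f v s.arr ∧ s'.reg (d + 1) = g v s.arr := by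
  obtain ⟨T, hT, hf⟩ := hf
  obtain ⟨T', hT', hg⟩ := hg
  refine ⟨_, hT.add hT', fun d xs hxs => ?_⟩
  obtain ⟨p, hp⟩ := hf d xs hxs
  obtain ⟨q, hq⟩ := hg (d + 1) xs fun x hx => (hxs x hx).trans d.lt_succ_self
  refine ⟨.seq p q, fun v s hv => (hp v s hv).seq fun s₁ ⟨hA₁, hr₁, hd₁⟩ => ?_⟩
  rw [← hA₁]
  refine (hq v s₁ (hv.congr hxs hr₁ (by rw [hA₁]))).mono le_rfl fun s₂ ⟨hA₂, hr₂, hd₂⟩ => ?_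
  exact ⟨hA₂, hr₂.trans hr₁ d.le_succ, by rw [hr₂ d d.lt_succ_self, hd₁, hA₁], hd₂⟩

theorem add (hf : PolyTime f) (hg : PolyTime g) : PolyTime fun v A => f v A + g v A := by
  obtain ⟨T, hT, h⟩ := exists_evaluates_pair hf hg
  refine ⟨_, hT.add (.const 4), fun d xs hxs => ?_⟩
  obtain ⟨p, hp⟩ := h d xs hxs
  refine ⟨.seq p (.assign d (.add (.reg d) (.reg (d + 1)))), fun v s hv =>
    (hp v s hv).seq fun s₁ ⟨hA, hr, hd, hd'⟩ => .assign ⟨hA, hr.setReg le_rfl, ?_⟩⟩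
  simp [State.setReg, Expr.eval, hd, hd']

theorem sub (hf : PolyTime f) (hg : PolyTime g) : PolyTime fun v A => f v A - g v A := by
  obtain ⟨T, hT, h⟩ := exists_evaluates_pair hf hg
  refine ⟨_, hT.add (.const 4), fun d xs hxs => ?_⟩
  obtain ⟨p, hp⟩ := h d xs hxs
  refine ⟨.seq p (.assign d (.sub (.reg d) (.reg (d + 1)))), fun v s hv =>
    (hp v s hv).seq fun s₁ ⟨hA, hr, hd, hd'⟩ => .assign ⟨hA, hr.setReg le_rfl, ?_⟩⟩
  simp [State.setReg, Expr.eval, hd, hd']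

theorem read (a : ℕ) (hf : PolyTime f) : PolyTime fun v A => A a (f v A) := by
  obtain ⟨T, hT, h⟩ := hf
  refine ⟨_, hT.add (.const 3), fun d xs hxs => ?_⟩
  obtain ⟨p, hp⟩ := h d xs hxs
  refine ⟨.seq p (.assign d (.read a (.reg d))), fun v s hv =>
    (hp v s hv).seq fun s₁ ⟨hA, hr, hd⟩ => .assign ⟨hA, hr.setReg le_rfl, ?_⟩⟩
  simp [State.setReg, Expr.eval, hd, hA]

theorem order : PolyTime fun (_ : V) A => A.order := (const 0).read 2

theorem numCodes : PolyTime fun (_ : V) A => A.numCodes := (const 0).read 3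

theorem cond (hc : PolyTime c) (hf : PolyTime f) (hg : PolyTime g) :
    PolyTime fun v A => if c v A ≠ 0 then f v A else g v A := by
  obtain ⟨Tc, hTc, hc⟩ := hc
  obtain ⟨T, hT, hf⟩ := hf
  obtain ⟨T', hT', hg⟩ := hg
  refine ⟨_, hTc.add ((PolyBounded.const 2).add (hT.add hT')), fun d xs hxs => ?_⟩
  obtain ⟨pc, hpc⟩ := hc d xs hxs
  obtain ⟨p, hp⟩ := hf d xs hxs
  obtain ⟨q, hq⟩ := hg d xs hxs
  refine ⟨.seq pc (.ite (.reg d) p q), fun v s hv => (hpc v s hv).seq fun s₁ ⟨hA, hr, hd⟩ => ?_⟩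
  rw [← hA] at hd ⊢
  have hv₁ := hv.congr hxs hr (by rw [hA])
  refine .ite (fun h => (hp v s₁ hv₁).mono le_rfl ?_) (fun h => (hq v s₁ hv₁).mono le_rfl ?_) <;>
  · rintro s₂ ⟨hA₂, hr₂, hd₂⟩
    refine ⟨hA₂, hr₂.trans hr le_rfl, ?_⟩
    simp only [Expr.eval, hd] at h
    simp [h, hd₂]

theorem sum {len : V → Memory → ℕ} {f : V × ℕ → Memory → ℕ} (hlen : LoopRange len)
    (hf : PolyTime f) : PolyTime fun v A => ∑ i ∈ Finset.range (len v A), f (v, i) A := by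
  obtain ⟨⟨Tl, hTl, hlen⟩, hle⟩ := hlen
  obtain ⟨T, hT, hf⟩ := hf
  refine ⟨_, hTl.add ((PolyBounded.const 2).add
    ((PolyBounded.id.mul ((hT.add (.const 4)).add (.const 8))).add (.const 6))), fun d xs hxs => ?_⟩
  obtain ⟨pl, hpl⟩ := hlen (d + 2) xs fun x hx => (hxs x hx).trans (by lia)
  obtain ⟨p, hp⟩ := hf (d + 3) ((d + 1) :: xs) (List.forall_mem_cons.2
    ⟨by lia, fun x hx => (hxs x hx).trans (by lia)⟩)
  refine ⟨.seq pl <| .seq (.assign d (.lit 0)) <| .countLoop (d + 1) (d + 2) <|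
    .seq p (.assign d (.add (.reg d) (.reg (d + 3)))), fun v s hv =>
    (hpl v s hv).seq fun s₁ ⟨hA₁, hr₁, hd₁⟩ => (Prog.EndsWithin.assign (Q := fun s₂ =>
      s₂.arr = s.arr ∧ s₂.AgreesBelow d s ∧ s₂.reg d = 0 ∧ s₂.reg (d + 2) = len v s.arr) ?_).seq
    fun s₂ ⟨hA₂, hr₂, hd₂, hl₂⟩ => ?_⟩
  · exact ⟨hA₁, (hr₁.mono (by lia)).setReg le_rfl, by simp [State.setReg, Expr.eval],
      by simp [State.setReg, hd₁]⟩
  have hl := hle v s.arr hv.2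
  refine (Prog.EndsWithin.countLoop (by lia) (fun i s' => s'.arr = s.arr ∧ s'.AgreesBelow d s ∧
    s'.reg d = ∑ j ∈ Finset.range i, f (v, j) s.arr) hl₂ ⟨hA₂, hr₂.setReg (by lia),
      by simp [State.setReg, hd₂]⟩ fun i hi s₃ ⟨hA₃, hr₃, hd₃⟩ hi₃ => ?_).mono
    (by gcongr) fun s' h => h
  have hv₃ : s₃.Stores ((d + 1) :: xs) (v, i) :=
    (hv.congr hxs hr₃ (by rw [hA₃])).cons hi₃ (by rw [hA₃]; exact hi.le.trans hl)
  rw [← hA₃]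
  refine (hp (v, i) s₃ hv₃).seq fun s₄ ⟨hA₄, hr₄, hd₄⟩ =>
    .assign ⟨⟨hA₄, ((hr₄.trans hr₃ (by lia)).setReg le_rfl).setReg (by lia), ?_⟩,
      ?_⟩
  · simp [State.setReg, Expr.eval, Finset.sum_range_succ, hd₄, hr₄ d (by lia), hd₃, hA₃]
  · simp [State.setReg, hr₄ (d + 1) (by lia), hr₄ (d + 2) (by lia)]

end PolyTime

namespace LoopRange

theorem order : LoopRange fun (_ : V) A => A.order :=
  ⟨.order, fun _ _ _ => Nat.le_add_right _ _⟩

theorem numCodes : LoopRange fun (_ : V) A => A.numCodes :=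
  ⟨.numCodes, fun _ _ _ => Nat.le_add_left _ _⟩

theorem last : LoopRange fun (v : V × ℕ) _ => v.2 :=
  ⟨.last, fun _ _ h => h _ List.mem_cons_self⟩

theorem weaken {len : V → Memory → ℕ} (h : LoopRange len) :
    LoopRange fun (v : V × ℕ) A => len v.1 A :=
  ⟨h.1.weaken, fun v A hv => h.2 v.1 A fun x hx => hv x (List.mem_cons_of_mem _ hx)⟩

end LoopRange

namespace PolyTimePred

variable {f g : V → Memory → ℕ} {P Q : V → Memory → Prop}

theorem ne_zero (hf : PolyTime f) : PolyTimePred fun v A => f v A ≠ 0 :=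
  ⟨f, hf, fun _ _ => Iff.rfl⟩

theorem of_iff (hP : PolyTimePred P) (h : ∀ v A, Q v A ↔ P v A) : PolyTimePred Q := by
  obtain ⟨f, hf, hP⟩ := hP
  exact ⟨f, hf, fun v A => (h v A).trans (hP v A)⟩

theorem not (hP : PolyTimePred P) : PolyTimePred fun v A => ¬ P v A := by
  obtain ⟨f, hf, hP⟩ := hP
  exact ⟨_, hf.cond (.const 0) (.const 1), fun v A => by simp [hP]⟩

theorem and (hP : PolyTimePred P) (hQ : PolyTimePred Q) :
    PolyTimePred fun v A => P v A ∧ Q v A := by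
  obtain ⟨f, hf, hP⟩ := hP
  obtain ⟨g, hg, hQ⟩ := hQ
  exact ⟨_, hf.cond hg (.const 0), fun v A => by simp [hP, hQ]⟩

theorem or (hP : PolyTimePred P) (hQ : PolyTimePred Q) : PolyTimePred fun v A => P v A ∨ Q v A :=
  (hP.not.and hQ.not).not.of_iff fun v A => by tauto

theorem imp (hP : PolyTimePred P) (hQ : PolyTimePred Q) :
    PolyTimePred fun v A => P v A → Q v A :=
  (hP.not.or hQ).of_iff fun v A => by tauto

theorem lt (hf : PolyTime f) (hg : PolyTime g) : PolyTimePred fun v A => f v A < g v A :=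
  (ne_zero (hg.sub hf)).of_iff fun v A => by lia

theorem le (hf : PolyTime f) (hg : PolyTime g) : PolyTimePred fun v A => f v A ≤ g v A :=
  (lt hg hf).not.of_iff fun _ _ => not_lt.symm

theorem eq (hf : PolyTime f) (hg : PolyTime g) : PolyTimePred fun v A => f v A = g v A :=
  ((le hf hg).and (le hg hf)).of_iff fun _ _ => le_antisymm_iff

variable {len : V → Memory → ℕ} {R : V × ℕ → Memory → Prop}

theorem exists_lt (hlen : LoopRange len) (hR : PolyTimePred R) :
    PolyTimePred fun v A => ∃ i < len v A, R (v, i) A := by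
  obtain ⟨f, hf, hR⟩ := hR
  refine ⟨_, PolyTime.sum hlen hf, fun v A => ?_⟩
  simp only [ne_eq, Finset.sum_eq_zero_iff, Finset.mem_range, not_forall, exists_prop]
  exact exists_congr fun i => and_congr_right fun _ => hR (v, i) A

theorem forall_lt (hlen : LoopRange len) (hR : PolyTimePred R) :
    PolyTimePred fun v A => ∀ i < len v A, R (v, i) A :=
  (exists_lt hlen hR.not).not.of_iff fun v A => by simp

end PolyTimePred

namespace PolyTime

variable {f g len : V → Memory → ℕ}

theorem ite {P : V → Memory → Prop} [∀ v A, Decidable (P v A)] (hP : PolyTimePred P)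
    (hf : PolyTime f) (hg : PolyTime g) :
    PolyTime fun v A => if P v A then f v A else g v A := by
  obtain ⟨c, hc, hP⟩ := hP
  simpa only [hP] using hc.cond hf hg

theorem card_filter {R : V × ℕ → Memory → Prop} [∀ v A, Decidable (R v A)] (hlen : LoopRange len)
    (hR : PolyTimePred R) :
    PolyTime fun v A => ((Finset.range (len v A)).filter fun i => R (v, i) A).card := by
  simp only [Finset.card_filter]
  exact sum hlen (ite hR (.const 1) (.const 0))

theorem mul (hf : LoopRange f) (hg : PolyTime g) : PolyTime fun v A => f v A * g v A := by
  simpa using sum hf hg.weaken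

theorem div (hf : LoopRange f) (hg : PolyTime g) : PolyTime fun v A => f v A / g v A := by
  have count (a b : ℕ) :
      a / b = if b = 0 then 0 else ((Finset.range a).filter fun q => q * b + b ≤ a).card := by
    rcases Nat.eq_zero_or_pos b with rfl | hb
    · simp
    have : (Finset.range a).filter (fun q => q * b + b ≤ a) = Finset.range (a / b) := by
      ext q
      have hq : q < a / b ↔ q * b + b ≤ a := by
        rw [← Nat.succ_le_iff, Nat.le_div_iff_mul_le hb, Nat.succ_mul]
      simp only [Finset.mem_filter, Finset.mem_range, hq, and_iff_right_iff_imp]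
      intro h
      nlinarith
    simp [this, hb.ne']
  simp only [count]
  exact ite (.eq hg (.const 0)) (.const 0)
    (card_filter hf (.le ((mul .last hg.weaken).add hg.weaken) hf.1.weaken))

theorem _root_.RAM.LoopRange.div (hf : LoopRange f) (hg : PolyTime g) :
    LoopRange fun v A => f v A / g v A :=
  ⟨PolyTime.div hf hg, fun v A hv => (Nat.div_le_self _ _).trans (hf.2 v A hv)⟩

theorem mod (hf : LoopRange f) (hg : PolyTime g) : PolyTime fun v A => f v A % g v A := by
  have eq_sub (a b : ℕ) : a % b = a - a / b * b := by
    rw [Nat.div_mul_self_eq_mod_sub_self]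
    have := Nat.mod_le a b
    lia
  simp only [eq_sub]
  exact hf.1.sub (mul (.div hf hg) hg)

end PolyTime

/-- The memory after the transformations `F 0`, …, `F (len - 1)`. -/
def forLoop (F : ℕ → Memory → Memory) : ℕ → Memory → Memory
  | 0, A => A
  | len + 1, A => F len (forLoop F len A)

theorem forLoop_induction {F : ℕ → Memory → Memory} {A : Memory} (P : ℕ → Memory → Prop)
    (len : ℕ) (zero : P 0 A) (succ : ∀ i < len, ∀ B, P i B → P (i + 1) (F i B)) :
    P len (forLoop F len A) := by
  suffices ∀ i ≤ len, P i (forLoop F i A) from this len le_rfl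
  intro i
  induction i with
  | zero => exact fun _ => zero
  | succ i ih => exact fun hi => succ i hi _ (ih (by lia))

namespace PolyTimeMap

variable {F G : V → Memory → Memory} {f g len : V → Memory → ℕ}

theorem id : PolyTimeMap fun (_ : V) A => A :=
  ⟨fun _ _ => rfl, fun _ => 1, .const 1, fun _ _ _ => ⟨.skip, fun _ s _ =>
    ⟨s, 1, .skip s, le_rfl, rfl, .refl⟩⟩⟩

theorem set (a : ℕ) (hf : PolyTime f) (hg : PolyTime g) (h2 : a ≠ 2 := by decide)
    (h3 : a ≠ 3 := by decide) : PolyTimeMap fun v A => A.set a (f v A) (g v A) := by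
  obtain ⟨T, hT, h⟩ := PolyTime.exists_evaluates_pair hf hg
  refine ⟨fun v A => by simp [Memory.size, Memory.order_set h2, Memory.numCodes_set h3],
    _, hT.add (.const 3), fun d xs hxs => ?_⟩
  obtain ⟨p, hp⟩ := h d xs hxs
  exact ⟨.seq p (.write a (.reg d) (.reg (d + 1))), fun v s hv =>
    (hp v s hv).seq fun s₁ ⟨hA, hr, hd, hd'⟩ => .write ⟨by
      simp [State.setArr, Expr.eval, hd, hd', hA, Memory.set], hr⟩⟩

theorem comp (hG : PolyTimeMap G) (hF : PolyTimeMap F) : PolyTimeMap fun v A => G v (F v A) := by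
  obtain ⟨hsF, T, hT, hF⟩ := hF
  obtain ⟨hsG, T', hT', hG⟩ := hG
  refine ⟨fun v A => (hsG v _).trans (hsF v A), _, hT.add hT', fun d xs hxs => ?_⟩
  obtain ⟨p, hp⟩ := hF d xs hxs
  obtain ⟨q, hq⟩ := hG d xs hxs
  refine ⟨.seq p q, fun v s hv => (hp v s hv).seq fun s₁ ⟨hA, hr⟩ => ?_⟩
  have hsize : Memory.size s₁.arr = Memory.size s.arr := by rw [hA, hsF]
  rw [← hsize]
  exact (hq v s₁ (hv.congr hxs hr hsize)).mono le_rfl fun s₂ ⟨hA₂, hr₂⟩ =>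
    ⟨hA₂.trans (congrArg (G v) hA), hr₂.trans hr le_rfl⟩

theorem ite {P : V → Memory → Prop} [∀ v A, Decidable (P v A)] (hP : PolyTimePred P)
    (hF : PolyTimeMap F) (hG : PolyTimeMap G) :
    PolyTimeMap fun v A => if P v A then F v A else G v A := by
  obtain ⟨c, ⟨Tc, hTc, hc⟩, hP⟩ := hP
  obtain ⟨hsF, T, hT, hF⟩ := hF
  obtain ⟨hsG, T', hT', hG⟩ := hG
  refine ⟨fun v A => by dsimp only; split_ifs <;> simp only [hsF, hsG],
    _, hTc.add ((PolyBounded.const 2).add (hT.add hT')), fun d xs hxs => ?_⟩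
  obtain ⟨pc, hpc⟩ := hc d xs hxs
  obtain ⟨p, hp⟩ := hF d xs hxs
  obtain ⟨q, hq⟩ := hG d xs hxs
  refine ⟨.seq pc (.ite (.reg d) p q), fun v s hv => (hpc v s hv).seq fun s₁ ⟨hA, hr, hd⟩ => ?_⟩
  rw [← hA] at hd ⊢
  have hv₁ := hv.congr hxs hr (by rw [hA])
  refine .ite (fun h => (hp v s₁ hv₁).mono le_rfl ?_) (fun h => (hq v s₁ hv₁).mono le_rfl ?_) <;>
  · rintro s₂ ⟨hA₂, hr₂⟩
    simp only [Expr.eval, hd] at h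
    exact ⟨by simp [hP, h, hA₂], hr₂.trans hr le_rfl⟩

theorem forLoop {F : V × ℕ → Memory → Memory} (hlen : LoopRange len) (hF : PolyTimeMap F) :
    PolyTimeMap fun v A => forLoop (fun i => F (v, i)) (len v A) A := by
  obtain ⟨⟨Tl, hTl, hlen⟩, hle⟩ := hlen
  obtain ⟨hsize, T, hT, hF⟩ := hF
  have hsize' (v : V) (A : Memory) (k : ℕ) :
      (RAM.forLoop (fun i => F (v, i)) k A).size = A.size := by
    induction k with
    | zero => rfl
    | succ k ih => exact (hsize (v, k) _).trans ih
  refine ⟨fun v A => hsize' v A _, _, hTl.add ((PolyBounded.id.mul (hT.add (.const 8))).add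
    (.const 6)), fun d xs hxs => ?_⟩
  obtain ⟨pl, hpl⟩ := hlen (d + 1) xs fun x hx => (hxs x hx).trans d.lt_succ_self
  obtain ⟨p, hp⟩ := hF (d + 2) (d :: xs) (List.forall_mem_cons.2
    ⟨by lia, fun x hx => (hxs x hx).trans (by lia)⟩)
  refine ⟨.seq pl (.countLoop d (d + 1) p), fun v s hv =>
    (hpl v s hv).seq fun s₁ ⟨hA₁, hr₁, hd₁⟩ => ?_⟩
  have hl := hle v s.arr hv.2
  refine (Prog.EndsWithin.countLoop (by lia)
    (fun i s' => s'.arr = RAM.forLoop (fun i => F (v, i)) i s.arr ∧ s'.AgreesBelow d s)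
    hd₁ ⟨hA₁, (hr₁.mono d.le_succ).setReg le_rfl⟩ fun i hi s₂ ⟨hA₂, hr₂⟩ hi₂ => ?_).mono
    (by gcongr) fun s' h => h
  have hs₂ : Memory.size s₂.arr = Memory.size s.arr := by rw [hA₂, hsize']
  have hv₂ : s₂.Stores (d :: xs) (v, i) :=
    (hv.congr hxs hr₂ hs₂).cons hi₂ (by rw [hs₂]; exact hi.le.trans hl)
  rw [← hs₂]
  exact (hp (v, i) s₂ hv₂).mono le_rfl fun s₃ ⟨hA₃, hr₃⟩ =>
    ⟨⟨hA₃.trans (congrArg (F (v, i)) hA₂), (hr₃.trans hr₂ (by lia)).setReg le_rfl⟩,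
      hr₃ d (by lia), hr₃ (d + 1) (by lia)⟩

end PolyTimeMap

end PolyTime

end RAM

/-! ### Rooted spanning forests -/

section Forests

variable {V : Type*} {H : SimpleGraph V} {root : V → V}

theorem exists_adj_dist_lt {x z : V} (h : H.Reachable x z) (hne : x ≠ z) :
    ∃ y, H.Adj x y ∧ H.dist y z < H.dist x z := by
  obtain ⟨p, hp⟩ := h.exists_walk_length_eq_dist
  cases p with
  | nil => exact absurd rfl hne
  | cons hadj q => exact ⟨_, hadj, by grw [← hp, SimpleGraph.dist_le q]; simp⟩

theorem eq_of_reachable_of_adj {x y : V} (hroot : ∀ x y, H.Adj x y → root x = root y)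
    (h : H.Reachable x y) : root x = root y := by
  obtain ⟨p⟩ := h
  induction p with
  | nil => rfl
  | cons hadj _ ih => exact (hroot _ _ hadj).trans ih

/-- `par` gives every vertex that is not its own root a neighbour nearer to its root, as measured by
`dep`. -/
def IsParentMap (H : SimpleGraph V) (root par : V → V) (dep : V → ℕ) : Prop :=
  ∀ x, root x ≠ x → H.Adj x (par x) ∧ dep (par x) < dep x

theorem exists_isParentMap (hroot : ∀ x y, H.Adj x y → root x = root y)
    (hreach : ∀ x, H.Reachable x (root x)) : ∃ par dep, IsParentMap H root par dep := by
  have hstep (x : V) : ∃ y, root x ≠ x → H.Adj x y ∧ H.dist y (root y) < H.dist x (root x) := by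
    by_cases hx : root x = x
    · exact ⟨x, absurd hx⟩
    · obtain ⟨y, hxy, hlt⟩ := exists_adj_dist_lt (hreach x) (Ne.symm hx)
      exact ⟨y, fun _ => ⟨hxy, hroot x y hxy ▸ hlt⟩⟩
  choose par hpar using hstep
  exact ⟨par, fun x => H.dist x (root x), hpar⟩

theorem IsParentMap.injOn_edge {par : V → V} {dep : V → ℕ} (h : IsParentMap H root par dep) :
    Set.InjOn (fun x => s(x, par x)) {x | root x ≠ x} := by
  intro x hx y hy hxy
  rcases Sym2.eq_iff.1 hxy with ⟨h₁, -⟩ | ⟨h₁, h₂⟩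
  · exact h₁
  · have hlt := (h x hx).2
    have hlt' := (h y hy).2
    rw [h₂] at hlt
    rw [← h₁] at hlt'
    exact absurd hlt hlt'.asymm

theorem IsParentMap.card_le_ncard_edgeSet {par : V → V} {dep : V → ℕ}
    (h : IsParentMap H root par dep) (hfin : H.edgeSet.Finite) {Z : Finset V}
    (hZ : ∀ x ∈ Z, root x ≠ x) : Z.card ≤ H.edgeSet.ncard := by
  rw [← Set.ncard_coe_finset]
  exact Set.ncard_le_ncard_of_injOn (fun x => s(x, par x)) (fun x hx => (h x (hZ x hx)).1)
    (h.injOn_edge.mono hZ) hfin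

theorem exists_spanning_forest (hroot : ∀ x y, H.Adj x y → root x = root y)
    (hreach : ∀ x, H.Reachable x (root x)) (hfin : {x | root x ≠ x}.Finite) :
    ∃ F ≤ H, F.edgeSet.ncard ≤ {x | root x ≠ x}.ncard ∧ ∀ x, F.Reachable x (root x) := by
  obtain ⟨par, dep, hpar⟩ := exists_isParentMap hroot hreach
  set E := (fun x => s(x, par x)) '' {x | root x ≠ x}
  refine ⟨.fromEdgeSet E, fun x y hxy => ?_, ?_, fun x => ?_⟩
  · obtain ⟨⟨z, hz, hze⟩, -⟩ := (SimpleGraph.fromEdgeSet_adj _).1 hxy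
    rw [← SimpleGraph.mem_edgeSet, ← hze]
    exact (hpar z hz).1
  · rw [SimpleGraph.edgeSet_fromEdgeSet]
    exact (Set.ncard_le_ncard Set.sdiff_subset (hfin.image _)).trans (Set.ncard_image_le hfin)
  · induction hd : dep x using Nat.strong_induction_on generalizing x with
    | _ d ih =>
      by_cases hx : root x = x
      · rw [hx]
      · have hadj : (SimpleGraph.fromEdgeSet E).Adj x (par x) :=
          (SimpleGraph.fromEdgeSet_adj _).2 ⟨⟨x, hx, rfl⟩, (hpar x hx).1.ne⟩
        rw [hroot _ _ (hpar x hx).1]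
        exact hadj.reachable.trans (ih _ (hd ▸ (hpar x hx).2) _ rfl)

theorem exists_root_mem (H : SimpleGraph V) (C : Set V) :
    ∃ root : V → V, (∀ x y, H.Adj x y → root x = root y) ∧ (∀ x, H.Reachable x (root x)) ∧
      ∀ x, ∀ c ∈ C, H.Reachable x c → root x ∈ C := by
  have hrep (K : H.ConnectedComponent) : ∃ r, H.connectedComponentMk r = K ∧
      ∀ c ∈ C, H.connectedComponentMk c = K → r ∈ C := by
    by_cases h : ∃ c ∈ C, H.connectedComponentMk c = K
    · obtain ⟨c, hc, hK⟩ := h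
      exact ⟨c, hK, fun _ _ _ => hc⟩
    · obtain ⟨v, rfl⟩ := K.exists_rep
      exact ⟨v, rfl, fun c hc hK => absurd ⟨c, hc, hK⟩ h⟩
  choose rep hrep hmem using hrep
  exact ⟨fun x => rep (H.connectedComponentMk x),
    fun x y hxy => congrArg rep (SimpleGraph.ConnectedComponent.sound hxy.reachable),
    fun x => SimpleGraph.ConnectedComponent.exact (hrep _).symm,
    fun x c hc hxc => hmem _ c hc (SimpleGraph.ConnectedComponent.sound hxc.symm)⟩

end Forests

/-! ### Plans for connecting the classes of a partition -/

/-- A graph with a vertex cover and a partition of its vertices into classes.  The vertices are the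
members of `verts`, and two of them are in the same class if `cls` has the same value at both. -/
structure PartitionedGraph (V : Type*) where
  graph : SimpleGraph V
  verts : Finset V
  cover : Finset V
  cls : V → V

namespace PartitionedGraph

variable {V : Type*}

/-- The requirements on the components of a partitioned graph. -/
structure IsProper (D : PartitionedGraph V) : Prop where
  mem_verts : ∀ {u v}, D.graph.Adj u v → u ∈ D.verts
  mem_cover : ∀ {u v}, D.graph.Adj u v → u ∈ D.cover ∨ v ∈ D.cover
  cover_subset : D.cover ⊆ D.verts
  cls_mem : ∀ {u}, u ∈ D.verts → D.cls u ∈ D.verts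

/-- Vertices of the same class are connected in `H`. -/
def Connects (D : PartitionedGraph V) (H : SimpleGraph V) : Prop :=
  ∀ u ∈ D.verts, ∀ v ∈ D.verts, D.cls u = D.cls v → H.Reachable u v

/-- The vertex `u` is not alone in its class. -/
def IsTerminal (D : PartitionedGraph V) (u : V) : Prop :=
  u ∈ D.verts ∧ ∃ w ∈ D.verts, w ≠ u ∧ D.cls w = D.cls u

end PartitionedGraph

/-- The trace of a rooted forest on a vertex cover `C`.  For `i ∈ C` that is not a root, `up i ∈ C`
is the parent of `i`, or the grandparent if the parent is outside of `C`, in which case we call the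
parent a hub.  Of the hubs only their classes are described: `i` and `j` are in the same group, with
a common representative `grp i = grp j`, if their hubs are in the same class. -/
structure Plan (V : Type*) where
  /-- the root of the component -/
  root : V → V
  /-- the parent or grandparent -/
  up : V → V
  /-- the representative of the group -/
  grp : V → V
  /-- the groups whose hub may be a vertex that is alone in its class -/
  lone : Finset V

namespace Plan

variable {V : Type*}

/-- All components of the plan live on `C`. -/
structure IsOn (C : Finset V) (p : Plan V) : Prop where
  root : Set.MapsTo p.root C C ∧ ∀ i ∉ C, p.root i = i
  up : Set.MapsTo p.up C C ∧ ∀ i ∉ C, p.up i = i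
  grp : Set.MapsTo p.grp C C ∧ ∀ i ∉ C, p.grp i = i
  lone : p.lone ⊆ C

variable (D : PartitionedGraph V) (p : Plan V)

/-- The vertex `i` needs a hub. -/
def UsesHub (i : V) : Prop :=
  i ∈ D.cover ∧ p.root i ≠ i ∧ ¬ D.graph.Adj i (p.up i)

/-- The vertex `g` represents a group. -/
def IsGroup (g : V) : Prop :=
  ∃ i, p.UsesHub D i ∧ p.grp i = g

/-- The class `r` can be made part of the component with root `b`. -/
def Fits (r b : V) : Prop :=
  ∀ u ∈ D.verts, D.cls u = r → (u ∈ D.cover ∧ p.root u = b) ∨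
    (u ∉ D.cover ∧ ∃ c ∈ D.cover, D.graph.Adj u c ∧ p.root c = b)

/-- The class `r` can supply the hubs of the group `g`. -/
structure Supplies (r g : V) : Prop where
  fits : p.Fits D r (p.root g)
  terminal : g ∉ p.lone → ∃ u, D.IsTerminal u ∧ D.cls u = r
  hub : ∀ i, p.UsesHub D i → p.grp i = g →
    ∃ v ∈ D.verts, D.cls v = r ∧ D.graph.Adj v i ∧ D.graph.Adj v (p.up i)

/-- If no member of `X` is a root, then `up` leads out of `X`. -/
def Leaves (X : Finset V) : Prop :=
  X.Nonempty → (∀ i ∈ X, p.root i ≠ i) → ∃ i ∈ X, p.up i ∉ X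

open Classical in
/-- Hall's condition for the choice of pairwise different classes that supply the groups, at a set
`X` of groups. -/
def HallAt (X : Finset V) : Prop :=
  (∀ g ∈ X, p.IsGroup D g) →
    X.card ≤ (D.verts.filter fun r => ∃ g ∈ X, p.Supplies D r g).card

/-- The conditions on the trace of a forest that do not quantify over sets. -/
structure IsConsistent : Prop where
  up_mem : ∀ i ∈ D.cover, p.up i ∈ D.cover
  root_up : ∀ i ∈ D.cover, p.root (p.up i) = p.root i
  grp_mem : ∀ i ∈ D.cover, p.UsesHub D i → p.grp i ∈ D.cover
  root_grp : ∀ i ∈ D.cover, p.UsesHub D i → p.root (p.grp i) = p.root i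
  terminal_fits : ∀ u ∈ D.verts, D.IsTerminal u → ∃ b ∈ D.verts, p.Fits D (D.cls u) b

/-- The conditions under which a plan is the trace of a forest that connects all classes. -/
structure IsValid : Prop extends p.IsConsistent D where
  leaves : ∀ X ⊆ D.cover, p.Leaves X
  hallAt : ∀ X ⊆ D.cover, p.HallAt D X

open Classical in
/-- An upper bound on the number of edges of a forest with the given trace: the number of vertices
that are not roots. -/
noncomputable def cost : ℕ :=
  (D.cover.filter fun i => p.root i ≠ i).card +
    (D.verts.filter fun u => u ∉ D.cover ∧ D.IsTerminal u).card +
    (D.cover.filter fun g => p.IsGroup D g ∧ g ∈ p.lone).card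

end Plan

/-! ### From plans to forests -/

namespace Plan

open PartitionedGraph

variable {V : Type*} {D : PartitionedGraph V} {p : Plan V}

theorem IsValid.isGroup_mem (hp : p.IsValid D) {g : V} (hg : p.IsGroup D g) : g ∈ D.cover := by
  obtain ⟨i, hi, rfl⟩ := hg
  exact hp.grp_mem i hi.1 hi

theorem IsValid.exists_supply (hp : p.IsValid D) :
    ∃ supply : V → V, Set.InjOn supply {g | p.IsGroup D g} ∧
      ∀ g, p.IsGroup D g → p.Supplies D (supply g) g := by
  classical
  let classes (g : {g // p.IsGroup D g}) : Finset V := D.verts.filter fun r => p.Supplies D r g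
  have hall (X : Finset {g // p.IsGroup D g}) : X.card ≤ (X.biUnion classes).card := by
    have h := hp.hallAt (X.map (.subtype _)) (fun g hg => by
      obtain ⟨g', -, rfl⟩ := Finset.mem_map.1 hg
      exact hp.isGroup_mem g'.2) fun g hg => by
      obtain ⟨g', -, rfl⟩ := Finset.mem_map.1 hg
      exact g'.2
    rw [Finset.card_map] at h
    convert h using 2
    ext r
    simp [classes]
    tauto
  obtain ⟨f, hf, hmem⟩ := (Finset.all_card_le_biUnion_card_iff_exists_injective classes).1 hall
  refine ⟨fun g => if hg : p.IsGroup D g then f ⟨g, hg⟩ else g, fun g hg g' hg' h => ?_,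
    fun g hg => ?_⟩
  · simp only [Set.mem_ofPred_eq] at hg hg'
    simp only [hg, hg', dite_true] at h
    exact congrArg Subtype.val (hf h)
  · simpa [hg] using (Finset.mem_filter.1 (hmem ⟨g, hg⟩)).2

/-- `label` extends the choice of roots from the cover to all vertices, in accordance with the plan
and with the choice `supply` of the classes of the hubs. -/
structure IsLabeling (D : PartitionedGraph V) (p : Plan V) (supply label : V → V) : Prop where
  eq_root : ∀ i ∈ D.cover, label i = p.root i
  supply_fits : ∀ g, p.IsGroup D g → ∀ v ∈ D.verts, D.cls v = supply g → label v = p.root g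
  terminal_eq : ∀ u v, D.IsTerminal u → v ∈ D.verts → D.cls u = D.cls v → label u = label v
  eq_self : ∀ v, label v ≠ v → v ∈ D.cover ∨ (v ∈ D.verts ∧
    (D.IsTerminal v ∨ ∃ g, p.IsGroup D g ∧ D.cls v = supply g))
  exists_adj : ∀ v ∉ D.cover, label v ≠ v → ∃ c ∈ D.cover, D.graph.Adj v c ∧ p.root c = label v

theorem IsValid.exists_target (hp : p.IsValid D) {supply : V → V}
    (hinj : Set.InjOn supply {g | p.IsGroup D g})
    (hsupply : ∀ g, p.IsGroup D g → p.Supplies D (supply g) g) (r : V) :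
    ∃ b, (∀ g, p.IsGroup D g → supply g = r → b = p.root g) ∧
      (((∃ u, D.IsTerminal u ∧ D.cls u = r) ∨ ∃ g, p.IsGroup D g ∧ r = supply g) →
        p.Fits D r b) := by
  by_cases h : ∃ g, p.IsGroup D g ∧ supply g = r
  · obtain ⟨g, hg, rfl⟩ := h
    exact ⟨p.root g, fun g' hg' h => by rw [hinj hg' hg h], fun _ => (hsupply g hg).fits⟩
  · by_cases h' : ∃ u, D.IsTerminal u ∧ D.cls u = r
    · obtain ⟨u, hu, rfl⟩ := h'
      obtain ⟨b, -, hb⟩ := hp.terminal_fits u hu.1 hu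
      exact ⟨b, fun g hg hr => absurd ⟨g, hg, hr⟩ h, fun _ => hb⟩
    · exact ⟨r, fun g hg hr => absurd ⟨g, hg, hr⟩ h,
        fun h'' => (h''.elim h' fun ⟨g, hg, hr⟩ => h ⟨g, hg, hr.symm⟩).elim⟩

theorem IsValid.exists_isLabeling (hp : p.IsValid D) {supply : V → V}
    (hinj : Set.InjOn supply {g | p.IsGroup D g})
    (hsupply : ∀ g, p.IsGroup D g → p.Supplies D (supply g) g) :
    ∃ label, p.IsLabeling D supply label := by
  classical
  choose target htarget hfits using hp.exists_target hinj hsupply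
  let Active (v : V) : Prop := v ∈ D.verts ∧
    (D.IsTerminal v ∨ ∃ g, p.IsGroup D g ∧ D.cls v = supply g)
  have hactive {v : V} (hv : Active v) : p.Fits D (D.cls v) (target (D.cls v)) :=
    hfits _ (hv.2.imp_left fun h => ⟨v, h, rfl⟩)
  let label (v : V) : V :=
    if v ∈ D.cover then p.root v else if Active v then target (D.cls v) else v
  have hlabel {v : V} (hv : Active v) : label v = target (D.cls v) := by
    simp only [label, hv, if_true, ite_eq_right_iff]
    intro hC
    exact ((hactive hv v hv.1 rfl).resolve_right fun h => h.1 hC).2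
  refine ⟨label, fun i hi => if_pos hi, fun g hg v hv hr => ?_, fun u v hu hv huv => ?_,
    fun v hv => ?_, fun v hv hne => ?_⟩
  · rw [hlabel ⟨hv, .inr ⟨g, hg, hr⟩⟩, htarget _ g hg hr.symm]
  · have hv' : D.IsTerminal v := by
      by_cases h : u = v
      · exact h ▸ hu
      · exact ⟨hv, u, hu.1, h, huv⟩
    rw [hlabel ⟨hu.1, .inl hu⟩, hlabel ⟨hv, .inl hv'⟩, huv]
  · by_contra! h
    exact hv (by simp only [label, h.1, if_false, show ¬ Active v from fun ha => by tauto])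
  · have ha : Active v := by
      by_contra ha
      simp [label, hv, ha] at hne
    rw [hlabel ha]
    exact ((hactive ha v ha.1 rfl).resolve_left fun h => hv h.1).2

/-- The edges of `G` between vertices with the same label. -/
def labelGraph (G : SimpleGraph V) (label : V → V) : SimpleGraph V where
  Adj u v := G.Adj u v ∧ label u = label v
  symm := ⟨fun _ _ h => ⟨h.1.symm, h.2.symm⟩⟩
  loopless := ⟨fun _ h => h.1.ne rfl⟩

theorem IsLabeling.reachable_up {supply label : V → V} (hl : p.IsLabeling D supply label)
    (hp : p.IsValid D) (hsupply : ∀ g, p.IsGroup D g → p.Supplies D (supply g) g) {i : V}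
    (hi : i ∈ D.cover) (hne : p.root i ≠ i) : (labelGraph D.graph label).Reachable i (p.up i) := by
  have hroot : label i = label (p.up i) := by
    rw [hl.eq_root i hi, hl.eq_root _ (hp.up_mem i hi), hp.root_up i hi]
  by_cases hadj : D.graph.Adj i (p.up i)
  · exact SimpleGraph.Adj.reachable ⟨hadj, hroot⟩
  · have hhub : p.UsesHub D i := ⟨hi, hne, hadj⟩
    have hg : p.IsGroup D (p.grp i) := ⟨i, hhub, rfl⟩
    obtain ⟨v, hv, hr, hvi, hvup⟩ := (hsupply _ hg).hub i hhub rfl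
    have hlv : label v = label i := by
      rw [hl.supply_fits _ hg v hv hr, hp.root_grp i hi hhub, hl.eq_root i hi]
    have hi' : (labelGraph D.graph label).Adj v i := ⟨hvi, hlv⟩
    have hup' : (labelGraph D.graph label).Adj v (p.up i) := ⟨hvup, hlv.trans hroot⟩
    exact hi'.symm.reachable.trans hup'.reachable

theorem IsLabeling.reachable_root {supply label : V → V} (hl : p.IsLabeling D supply label)
    (hp : p.IsValid D) (hsupply : ∀ g, p.IsGroup D g → p.Supplies D (supply g) g) :
    ∀ i ∈ D.cover, (labelGraph D.graph label).Reachable i (p.root i) := by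
  classical
  set H := labelGraph D.graph label
  by_contra! h
  obtain ⟨i, hi, hir⟩ := h
  obtain ⟨j, hj, hup_mem⟩ := hp.leaves (D.cover.filter fun i => ¬ H.Reachable i (p.root i))
    (Finset.filter_subset _ _) ⟨i, Finset.mem_filter.2 ⟨hi, hir⟩⟩ fun j hj hjr =>
      (Finset.mem_filter.1 hj).2 (by rw [hjr])
  obtain ⟨hj, hjr⟩ := Finset.mem_filter.1 hj
  have hupr : H.Reachable (p.up j) (p.root (p.up j)) := by
    by_contra hupr
    exact hup_mem (Finset.mem_filter.2 ⟨hp.up_mem j hj, hupr⟩)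
  have hne : p.root j ≠ j := fun h => hjr (by rw [h])
  exact hjr ((hl.reachable_up hp hsupply hj hne).trans (hp.root_up j hj ▸ hupr))

theorem IsLabeling.reachable {supply label : V → V} (hl : p.IsLabeling D supply label)
    (hp : p.IsValid D) (hsupply : ∀ g, p.IsGroup D g → p.Supplies D (supply g) g) (x : V) :
    (labelGraph D.graph label).Reachable x (label x) := by
  by_cases hx : x ∈ D.cover
  · rw [hl.eq_root x hx]
    exact hl.reachable_root hp hsupply x hx
  · by_cases hne : label x = x
    · rw [hne]
    · obtain ⟨c, hc, hxc, hroot⟩ := hl.exists_adj x hx hne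
      have hadj : (labelGraph D.graph label).Adj x c := ⟨hxc, hroot ▸ (hl.eq_root c hc).symm⟩
      exact hadj.reachable.trans (hroot ▸ hl.reachable_root hp hsupply c hc)

theorem IsValid.card_lone_hubs_le (hp : p.IsValid D) {supply : V → V}
    (hsupply : ∀ g, p.IsGroup D g → p.Supplies D (supply g) g)
    {Z : Finset V} (hZ : ∀ v ∈ Z, v ∈ D.verts ∧ ¬ D.IsTerminal v ∧
      ∃ g, p.IsGroup D g ∧ D.cls v = supply g)
    {L : Finset V} (hL : ∀ g ∈ D.cover, p.IsGroup D g → g ∈ p.lone → g ∈ L) :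
    Z.card ≤ L.card := by
  refine Finset.card_le_card_of_forall_subsingleton (fun v g => D.cls v = supply g) (fun v hv => ?_)
    fun g _ v hv v' hv' => ?_
  · obtain ⟨hverts, hterm, g, hg, hcls⟩ := hZ v hv
    refine ⟨g, hL g (hp.isGroup_mem hg) hg ?_, hcls⟩
    by_contra hlone
    obtain ⟨u, hu, hur⟩ := (hsupply g hg).terminal hlone
    rcases eq_or_ne u v with rfl | hne
    · exact hterm hu
    · exact hterm ⟨hverts, u, hu.1, hne, hur.trans hcls.symm⟩
  · by_contra hne
    obtain ⟨hverts, hterm, -⟩ := hZ v hv.1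
    exact hterm ⟨hverts, v', (hZ v' hv'.1).1, Ne.symm hne, hv'.2.trans hv.2.symm⟩

theorem IsLabeling.finite_ncard_le {supply label : V → V} (hl : p.IsLabeling D supply label)
    (hp : p.IsValid D) (hsupply : ∀ g, p.IsGroup D g → p.Supplies D (supply g) g) :
    {x | label x ≠ x}.Finite ∧ {x | label x ≠ x}.ncard ≤ p.cost D := by
  classical
  set nonroots := D.cover.filter fun i => p.root i ≠ i
  set terminals := D.verts.filter fun u => u ∉ D.cover ∧ D.IsTerminal u
  set hubs := D.verts.filter fun v => ¬ D.IsTerminal v ∧ ∃ g, p.IsGroup D g ∧ D.cls v = supply g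
  have hsub : {x | label x ≠ x} ⊆ (↑(nonroots ∪ terminals ∪ hubs) : Set V) := by
    intro x hx
    simp only [nonroots, terminals, hubs, Finset.coe_union, Finset.coe_filter, Set.mem_union]
    by_cases hC : x ∈ D.cover
    · exact .inl (.inl ⟨hC, hl.eq_root x hC ▸ hx⟩)
    · obtain ⟨hv, h⟩ := (hl.eq_self x hx).resolve_left hC
      by_cases ht : D.IsTerminal x
      · exact .inl (.inr ⟨hv, hC, ht⟩)
      · exact .inr ⟨hv, ht, h.resolve_left ht⟩
  refine ⟨(Finset.finite_toSet _).subset hsub, ?_⟩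
  calc {x | label x ≠ x}.ncard ≤ (nonroots ∪ terminals ∪ hubs).card := by
        rw [← Set.ncard_coe_finset]
        exact Set.ncard_le_ncard hsub (Finset.finite_toSet _)
    _ ≤ nonroots.card + terminals.card + hubs.card := by
        grw [Finset.card_union_le, Finset.card_union_le]
    _ ≤ p.cost D := by
        refine Nat.add_le_add_left (hp.card_lone_hubs_le hsupply (fun v hv => ?_)
          fun g hC hg hlone => Finset.mem_filter.2 ⟨hC, hg, hlone⟩) _
        exact Finset.mem_filter.1 hv

theorem IsValid.exists_forest (hp : p.IsValid D) :
    ∃ F ≤ D.graph, D.Connects F ∧ F.edgeSet.ncard ≤ p.cost D := by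
  obtain ⟨supply, hinj, hsupply⟩ := hp.exists_supply
  obtain ⟨label, hl⟩ := hp.exists_isLabeling hinj hsupply
  obtain ⟨hfin, hcost⟩ := hl.finite_ncard_le hp hsupply
  obtain ⟨F, hF, hcard, hreach⟩ := exists_spanning_forest (H := labelGraph D.graph label)
    (fun _ _ h => h.2) (hl.reachable hp hsupply) hfin
  refine ⟨F, fun _ _ h => (hF h).1, fun u hu v hv huv => ?_, hcard.trans hcost⟩
  rcases eq_or_ne u v with rfl | hne
  · rfl
  · have hlabel := hl.terminal_eq u v ⟨hu, v, hv, hne.symm, huv.symm⟩ hv huv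
    exact (hreach u).trans (hlabel ▸ (hreach v).symm)

end Plan

/-! ### From forests to plans -/

/-- A rooted spanning forest of `H`, described by its roots, parents and depths, in which the root
of a component is in `C` wherever possible. -/
structure RootedForest {V : Type*} (H : SimpleGraph V) (C : Finset V) where
  root : V → V
  par : V → V
  dep : V → ℕ
  root_eq : ∀ x y, H.Adj x y → root x = root y
  root_mem : ∀ x, ∀ c ∈ C, H.Reachable x c → root x ∈ C
  isParentMap : IsParentMap H root par dep

namespace RootedForest

variable {V : Type*} {H : SimpleGraph V}

theorem nonempty (H : SimpleGraph V) (C : Finset V) : Nonempty (RootedForest H C) := by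
  obtain ⟨root, hroot, hreach, hmem⟩ := exists_root_mem H C
  obtain ⟨par, dep, hpar⟩ := exists_isParentMap hroot hreach
  exact ⟨⟨root, par, dep, hroot, hmem, hpar⟩⟩

theorem adj_par {C : Finset V} (T : RootedForest H C) {x : V} (hx : T.root x ≠ x) :
    H.Adj x (T.par x) :=
  (T.isParentMap x hx).1

theorem root_par {C : Finset V} (T : RootedForest H C) {x : V} (hx : T.root x ≠ x) :
    T.root (T.par x) = T.root x :=
  (T.root_eq _ _ (T.adj_par hx)).symm

variable {D : PartitionedGraph V} (T : RootedForest H D.cover)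

theorem par_mem (hD : D.IsProper) (hH : H ≤ D.graph) {x : V} (hx : x ∉ D.cover)
    (hroot : T.root x ∈ D.cover) : T.root x ≠ x ∧ T.par x ∈ D.cover := by
  have hne : T.root x ≠ x := fun h => hx (h ▸ hroot)
  exact ⟨hne, (hD.mem_cover (hH (T.adj_par hne))).resolve_left hx⟩

theorem root_mem_of_isTerminal (hD : D.IsProper) (hH : H ≤ D.graph) (hcon : D.Connects H) {u : V}
    (hu : D.IsTerminal u) : T.root u ∈ D.cover := by
  obtain ⟨hverts, w, hw, hne, hcls⟩ := hu
  obtain ⟨y, hy, -⟩ := exists_adj_dist_lt (hcon u hverts w hw hcls.symm) hne.symm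
  rcases hD.mem_cover (hH hy) with hC | hC
  · exact T.root_mem u u hC .rfl
  · exact T.root_mem u y hC hy.reachable

theorem root_eq_of_connects (hcon : D.Connects H) {u v : V} (hu : u ∈ D.verts) (hv : v ∈ D.verts)
    (h : D.cls u = D.cls v) : T.root u = T.root v :=
  eq_of_reachable_of_adj T.root_eq (hcon u hu v hv h)

/-- The members of the cover whose parent is outside of the cover. -/
def hubUsers : Set V :=
  {i | i ∈ D.cover ∧ T.root i ≠ i ∧ T.par i ∉ D.cover}

theorem hub_spec (hD : D.IsProper) (hH : H ≤ D.graph) {i : V} (hi : i ∈ T.hubUsers) :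
    T.root (T.par i) ≠ T.par i ∧ T.par (T.par i) ∈ D.cover :=
  T.par_mem hD hH hi.2.2 (T.root_par hi.2.1 ▸ T.root_mem i i hi.1 .rfl)

/-- The class of the parent, which is the class of the hub if there is one. -/
def hubClass (i : V) : V :=
  D.cls (T.par i)

open Classical in
/-- The trace of a rooted forest on the cover. -/
noncomputable def trace [Nonempty V] : Plan V where
  root i := if i ∈ D.cover then T.root i else i
  up i := if i ∈ D.cover ∧ T.root i ≠ i then
    if T.par i ∈ D.cover then T.par i else T.par (T.par i) else i
  grp i := if i ∈ T.hubUsers then Function.invFunOn T.hubClass T.hubUsers (T.hubClass i) else i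
  lone := D.cover.filter fun g => ¬ D.IsTerminal (T.par g)

variable [Nonempty V]

theorem trace_root {i : V} (hi : i ∈ D.cover) : T.trace.root i = T.root i :=
  if_pos hi

theorem mem_trace_lone {g : V} :
    g ∈ T.trace.lone ↔ g ∈ D.cover ∧ ¬ D.IsTerminal (T.par g) := by
  classical
  exact Finset.mem_filter

theorem trace_up_of_mem {i : V} (hi : i ∈ D.cover) (hne : T.root i ≠ i) (hpar : T.par i ∈ D.cover) :
    T.trace.up i = T.par i := by
  simp [trace, hi, hne, hpar]

theorem trace_up_of_mem_hubUsers {i : V} (hi : i ∈ T.hubUsers) :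
    T.trace.up i = T.par (T.par i) := by
  simp [trace, hi.1, hi.2.1, hi.2.2]

theorem trace_grp_spec {i : V} (hi : i ∈ T.hubUsers) :
    T.trace.grp i ∈ T.hubUsers ∧ T.hubClass (T.trace.grp i) = T.hubClass i := by
  rw [show T.trace.grp i = _ from if_pos hi]
  exact ⟨Function.invFunOn_mem ⟨i, hi, rfl⟩, Function.invFunOn_eq ⟨i, hi, rfl⟩⟩

theorem trace_up_spec (hD : D.IsProper) (hH : H ≤ D.graph) {i : V} (hi : i ∈ D.cover)
    (hne : T.root i ≠ i) : T.trace.up i ∈ D.cover ∧ T.root (T.trace.up i) = T.root i ∧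
      T.dep (T.trace.up i) < T.dep i := by
  have hlt := (T.isParentMap i hne).2
  by_cases hpar : T.par i ∈ D.cover
  · rw [T.trace_up_of_mem hi hne hpar]
    exact ⟨hpar, T.root_par hne, hlt⟩
  · have hub : i ∈ T.hubUsers := ⟨hi, hne, hpar⟩
    obtain ⟨hne', hmem⟩ := T.hub_spec hD hH hub
    rw [T.trace_up_of_mem_hubUsers hub]
    exact ⟨hmem, (T.root_par hne').trans (T.root_par hne), (T.isParentMap _ hne').2.trans hlt⟩

theorem trace_isOn (hD : D.IsProper) (hH : H ≤ D.graph) : T.trace.IsOn D.cover where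
  root := ⟨fun i hi => by rw [T.trace_root hi]; exact T.root_mem i i hi .rfl,
    fun i hi => if_neg hi⟩
  up := by
    refine ⟨fun i hi => ?_, fun i hi => if_neg fun h => hi h.1⟩
    by_cases hne : T.root i = i
    · rwa [show T.trace.up i = i from if_neg fun h => h.2 hne]
    · exact (T.trace_up_spec hD hH hi hne).1
  grp := by
    refine ⟨fun i hi => ?_, fun i hi => if_neg fun h => hi h.1⟩
    by_cases hub : i ∈ T.hubUsers
    · exact (T.trace_grp_spec hub).1.1
    · rwa [show T.trace.grp i = i from if_neg hub]
  lone _ hg := (T.mem_trace_lone.1 hg).1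

theorem mem_hubUsers_of_usesHub (hH : H ≤ D.graph) {i : V} (hi : T.trace.UsesHub D i) :
    i ∈ T.hubUsers := by
  obtain ⟨hC, hne, hadj⟩ := hi
  rw [T.trace_root hC] at hne
  refine ⟨hC, hne, fun hpar => hadj ?_⟩
  rw [T.trace_up_of_mem hC hne hpar]
  exact hH (T.adj_par hne)

theorem mem_hubUsers_of_isGroup (hH : H ≤ D.graph) {g : V} (hg : T.trace.IsGroup D g) :
    g ∈ T.hubUsers := by
  obtain ⟨i, hi, rfl⟩ := hg
  exact (T.trace_grp_spec (T.mem_hubUsers_of_usesHub hH hi)).1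

theorem injOn_hubClass (hH : H ≤ D.graph) : Set.InjOn T.hubClass {g | T.trace.IsGroup D g} := by
  rintro _ ⟨i, hi, rfl⟩ _ ⟨j, hj, rfl⟩ h
  have hi' := T.mem_hubUsers_of_usesHub hH hi
  have hj' := T.mem_hubUsers_of_usesHub hH hj
  rw [(T.trace_grp_spec hi').2, (T.trace_grp_spec hj').2] at h
  simp only [trace, hi', hj', if_true, h]

theorem trace_fits (hD : D.IsProper) (hH : H ≤ D.graph) {r b : V} (hb : b ∈ D.cover)
    (h : ∀ u ∈ D.verts, D.cls u = r → T.root u = b) : T.trace.Fits D r b := by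
  intro u hu hr
  have hub := h u hu hr
  by_cases hC : u ∈ D.cover
  · exact .inl ⟨hC, T.trace_root hC ▸ hub⟩
  · obtain ⟨hne, hpar⟩ := T.par_mem hD hH hC (hub ▸ hb)
    exact .inr ⟨hC, T.par u, hpar, hH (T.adj_par hne),
      by rw [T.trace_root hpar, T.root_par hne, hub]⟩

theorem trace_supplies (hD : D.IsProper) (hH : H ≤ D.graph) (hcon : D.Connects H) {g : V}
    (hg : g ∈ T.hubUsers) : T.trace.Supplies D (T.hubClass g) g where
  fits := by
    have hroot : T.root g ∈ D.cover := T.root_mem g g hg.1 .rfl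
    rw [T.trace_root hg.1]
    refine T.trace_fits hD hH hroot fun u hu hcls => ?_
    have hverts : T.par g ∈ D.verts := hD.mem_verts (hH (T.adj_par hg.2.1).symm)
    rw [T.root_eq_of_connects hcon hu hverts hcls, T.root_par hg.2.1]
  terminal hlone := by
    refine ⟨T.par g, ?_, rfl⟩
    by_contra h
    exact hlone (T.mem_trace_lone.2 ⟨hg.1, h⟩)
  hub i hi hgrp := by
    have hi' := T.mem_hubUsers_of_usesHub hH hi
    have hadj := hH (T.adj_par hi'.2.1).symm
    refine ⟨T.par i, hD.mem_verts hadj, ?_, hadj, ?_⟩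
    · rw [← hgrp, (T.trace_grp_spec hi').2, hubClass]
    · rw [T.trace_up_of_mem_hubUsers hi']
      exact hH (T.adj_par (T.hub_spec hD hH hi').1)

theorem trace_isValid (hD : D.IsProper) (hH : H ≤ D.graph) (hcon : D.Connects H) :
    T.trace.IsValid D where
  up_mem i hi := (T.trace_isOn hD hH).up.1 hi
  root_up i hi := by
    rw [T.trace_root hi, T.trace_root ((T.trace_isOn hD hH).up.1 hi)]
    by_cases hne : T.root i = i
    · rw [show T.trace.up i = i from if_neg fun h => h.2 hne]
    · exact (T.trace_up_spec hD hH hi hne).2.1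
  leaves X hXC hX hroot := by
    obtain ⟨i, hi, hmin⟩ := X.exists_min_image T.dep hX
    have hne := hroot i hi
    rw [T.trace_root (hXC hi)] at hne
    exact ⟨i, hi, fun hup => (T.trace_up_spec hD hH (hXC hi) hne).2.2.not_ge (hmin _ hup)⟩
  root_grp i _ hi := by
    have hi' := T.mem_hubUsers_of_usesHub hH hi
    obtain ⟨hg, hcls⟩ := T.trace_grp_spec hi'
    rw [T.trace_root hi'.1, T.trace_root hg.1, ← T.root_par hi'.2.1, ← T.root_par hg.2.1]
    exact T.root_eq_of_connects hcon (hD.mem_verts (hH (T.adj_par hg.2.1).symm))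
      (hD.mem_verts (hH (T.adj_par hi'.2.1).symm)) hcls
  grp_mem i _ hi := (T.trace_grp_spec (T.mem_hubUsers_of_usesHub hH hi)).1.1
  hallAt X _ hgroup := by
    classical
    refine Finset.card_le_card_of_injOn T.hubClass (fun g hg => ?_)
      ((T.injOn_hubClass hH).mono hgroup)
    have hg' := T.mem_hubUsers_of_isGroup hH (hgroup g hg)
    exact Finset.mem_filter.2 ⟨hD.cls_mem (hD.mem_verts (hH (T.adj_par hg'.2.1).symm)), g, hg,
      T.trace_supplies hD hH hcon hg'⟩
  terminal_fits u _ hu := by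
    have hroot := T.root_mem_of_isTerminal hD hH hcon hu
    exact ⟨_, hD.cover_subset hroot, T.trace_fits hD hH hroot fun w hw hcls =>
      T.root_eq_of_connects hcon hw hu.1 hcls⟩

theorem cost_trace_le (hD : D.IsProper) (hH : H ≤ D.graph) (hcon : D.Connects H)
    (hfin : H.edgeSet.Finite) : T.trace.cost D ≤ H.edgeSet.ncard := by
  classical
  unfold Plan.cost
  set nonroots := D.cover.filter fun i => T.trace.root i ≠ i
  set terminals := D.verts.filter fun u => u ∉ D.cover ∧ D.IsTerminal u
  set groups := D.cover.filter fun g => T.trace.IsGroup D g ∧ g ∈ T.trace.lone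
  have hgroup : ∀ g ∈ groups, T.trace.IsGroup D g ∧ g ∈ T.hubUsers ∧ ¬ D.IsTerminal (T.par g) :=
    fun g hg => by
      obtain ⟨-, hg, hlone⟩ := Finset.mem_filter.1 hg
      exact ⟨hg, T.mem_hubUsers_of_isGroup hH hg, (T.mem_trace_lone.1 hlone).2⟩
  have hinj : Set.InjOn T.par groups := fun g hg g' hg' h =>
    T.injOn_hubClass hH (hgroup g hg).1 (hgroup g' hg').1 (congrArg D.cls h)
  have hdisj : Disjoint nonroots terminals :=
    Finset.disjoint_left.2 fun x hx hx' =>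
      (Finset.mem_filter.1 hx').2.1 (Finset.mem_filter.1 hx).1
  have hdisj' : Disjoint (nonroots ∪ terminals) (groups.image T.par) := by
    rw [Finset.disjoint_right]
    intro x hx hx'
    obtain ⟨g, hg, rfl⟩ := Finset.mem_image.1 hx
    rcases Finset.mem_union.1 hx' with h | h
    · exact (hgroup g hg).2.1.2.2 (Finset.mem_filter.1 h).1
    · exact (hgroup g hg).2.2 (Finset.mem_filter.1 h).2.2
  rw [← Finset.card_image_of_injOn hinj, ← Finset.card_union_of_disjoint hdisj,
    ← Finset.card_union_of_disjoint hdisj']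
  refine T.isParentMap.card_le_ncard_edgeSet hfin fun x hx => ?_
  rcases Finset.mem_union.1 hx with hx | hx
  · rcases Finset.mem_union.1 hx with hx | hx
    · obtain ⟨hC, hne⟩ := Finset.mem_filter.1 hx
      exact T.trace_root hC ▸ hne
    · obtain ⟨-, hC, hterm⟩ := Finset.mem_filter.1 hx
      exact (T.par_mem hD hH hC (T.root_mem_of_isTerminal hD hH hcon hterm)).1
  · obtain ⟨g, hg, rfl⟩ := Finset.mem_image.1 hx
    exact (T.hub_spec hD hH (hgroup g hg).2.1).1

end RootedForest

theorem PartitionedGraph.exists_plan_iff {V : Type*} [Nonempty V] {D : PartitionedGraph V}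
    (hD : D.IsProper) {plans : Set (Plan V)} (hplans : ∀ p, p.IsOn D.cover → p ∈ plans) (l : ℕ) :
    (∃ p ∈ plans, p.IsValid D ∧ p.cost D ≤ l) ↔
      ∃ H ≤ D.graph, D.Connects H ∧ H.edgeSet.ncard ≤ l := by
  constructor
  · rintro ⟨p, -, hp, hl⟩
    obtain ⟨F, hF, hcon, hcard⟩ := hp.exists_forest
    exact ⟨F, hF, hcon, hcard.trans hl⟩
  · rintro ⟨H, hH, hcon, hl⟩
    obtain ⟨T⟩ := RootedForest.nonempty H D.cover
    have hfin : H.edgeSet.Finite := by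
      refine (D.verts.sym2.finite_toSet).subset fun e he => ?_
      induction e with
      | _ u v =>
        exact Finset.mk_mem_sym2_iff.2
          ⟨hD.mem_verts (hH he), hD.mem_verts (hH (SimpleGraph.Adj.symm he))⟩
    exact ⟨T.trace, hplans _ (T.trace_isOn hD hH), T.trace_isValid hD hH hcon,
      (T.cost_trace_le hD hH hcon hfin).trans hl⟩

/-! ### Plans and graphs in the memory -/

namespace RAM

namespace Memory

variable (A : Memory)

/-- The position of the adjacency matrix in array `0`. -/
def offset : ℕ := A 4 0

/-- The position of an entry of the adjacency matrix in array `0`. -/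
def edgeCell (u v : ℕ) : ℕ := A.offset + (A.order * u + v)

/-- The graph in the memory.  An edge is present only if both of its entries in the adjacency matrix
are nonzero, hence it can be deleted and restored by writing to one of them. -/
def graph : SimpleGraph ℕ where
  Adj u v := u ≠ v ∧ (u < A.order ∧ v < A.order) ∧
    A 0 (A.edgeCell u v) ≠ 0 ∧ A 0 (A.edgeCell v u) ≠ 0
  symm := ⟨fun _ _ h => ⟨h.1.symm, h.2.1.symm, h.2.2.symm⟩⟩
  loopless := ⟨fun _ h => h.1 rfl⟩

/-- The set of vertices that are marked in array `5`. -/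
def cover : Finset ℕ := (Finset.range A.order).filter fun u => A 5 u ≠ 0

/-- The partitioned graph in the memory.  The classes are in array `6`. -/
def partitionedGraph : PartitionedGraph ℕ := ⟨A.graph, Finset.range A.order, A.cover, A 6⟩

/-- The number of members of the cover below `i`. -/
def rank (i : ℕ) : ℕ := ((Finset.range i).filter fun j => j ∈ A.cover).card

/-- The member of the cover of rank `r`. -/
def ofRank (r : ℕ) : ℕ :=
  ∑ c ∈ Finset.range A.order, if c ∈ A.cover ∧ A.rank c = r then c else 0

/-- The digit of `N` that belongs to the member `i` of the cover.  The base is one more than the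
size of the cover, and the place value is in array `7`, see `HasPlaceValues`. -/
def digit (N i : ℕ) : ℕ := N / A 7 i % (A.cover.card + 1)

/-- The map with code `N`. -/
def mapOfCode (N i : ℕ) : ℕ := if i ∈ A.cover then A.ofRank (A.digit N i) else i

/-- The subset of the cover with code `N`. -/
def setOfCode (N : ℕ) : Finset ℕ := A.cover.filter fun i => A.digit N i ≠ 0

/-- The plan whose components have the codes `N 0`, …, `N 3`. -/
def planOfCodes (N : Fin 4 → ℕ) : Plan ℕ :=
  ⟨A.mapOfCode (N 0), A.mapOfCode (N 1), A.mapOfCode (N 2), A.setOfCode (N 3)⟩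

/-- The powers that are needed to access the digits of codes are available. -/
structure HasPlaceValues : Prop where
  placeValue : ∀ i ∈ A.cover, A 7 i = (A.cover.card + 1) ^ A.rank i
  numCodes_eq : A.numCodes = (A.cover.card + 1) ^ A.cover.card

variable {A}

theorem lt_order_of_mem_cover {i : ℕ} (hi : i ∈ A.cover) : i < A.order :=
  Finset.mem_range.1 (Finset.mem_filter.1 hi).1

theorem card_cover_le : A.cover.card ≤ A.order :=
  (Finset.card_filter_le _ _).trans (Finset.card_range _).le

theorem rank_lt {i j : ℕ} (hi : i ∈ A.cover) (hij : i < j) : A.rank i < A.rank j := by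
  refine Finset.card_lt_card ((Finset.ssubset_iff_of_subset fun c hc => ?_).2 ⟨i, ?_, ?_⟩)
  · obtain ⟨hlt, hc⟩ := Finset.mem_filter.1 hc
    exact Finset.mem_filter.2 ⟨Finset.mem_range.2 ((Finset.mem_range.1 hlt).trans hij), hc⟩
  · exact Finset.mem_filter.2 ⟨Finset.mem_range.2 hij, hi⟩
  · simp

theorem rank_order : A.rank A.order = A.cover.card := by
  refine congrArg Finset.card (Finset.ext fun i => ?_)
  simpa using fun hi => lt_order_of_mem_cover hi

theorem rank_lt_card {i : ℕ} (hi : i ∈ A.cover) : A.rank i < A.cover.card :=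
  rank_order (A := A) ▸ rank_lt hi (lt_order_of_mem_cover hi)

theorem rank_injOn : Set.InjOn A.rank A.cover := fun i hi j hj h => by
  rcases lt_trichotomy i j with hij | rfl | hij
  · exact absurd h (rank_lt hi hij).ne
  · rfl
  · exact absurd h (rank_lt hj hij).ne'

theorem ofRank_rank {i : ℕ} (hi : i ∈ A.cover) : A.ofRank (A.rank i) = i := by
  rw [ofRank, Finset.sum_eq_single i]
  · simp [hi]
  · exact fun c _ hne => if_neg fun h => hne (rank_injOn h.1 hi h.2)
  · exact fun h => absurd (Finset.mem_range.2 (lt_order_of_mem_cover hi)) h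

theorem HasPlaceValues.exists_digit_eq (hA : A.HasPlaceValues) {d : ℕ → ℕ}
    (hd : ∀ i ∈ A.cover, d i ≤ A.cover.card) :
    ∃ N < A.numCodes, ∀ i ∈ A.cover, A.digit N i = d i := by
  let w (r : Fin A.cover.card) : Fin (A.cover.card + 1) := Fin.ofNat _ (d (A.ofRank r))
  refine ⟨finFunctionFinEquiv w, by rw [hA.numCodes_eq]; exact Fin.is_lt _, fun i hi => ?_⟩
  have h := congrFun (finFunctionFinEquiv.symm_apply_apply w) ⟨A.rank i, rank_lt_card hi⟩
  rw [digit, hA.placeValue i hi]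
  refine (congrArg Fin.val h).trans ?_
  simp [w, ofRank_rank hi, Nat.mod_eq_of_lt (Nat.lt_succ_of_le (hd i hi))]

theorem HasPlaceValues.exists_mapOfCode_eq (hA : A.HasPlaceValues) {f : ℕ → ℕ}
    (hf : Set.MapsTo f A.cover A.cover ∧ ∀ i ∉ A.cover, f i = i) :
    ∃ N < A.numCodes, A.mapOfCode N = f := by
  obtain ⟨N, hN, hdigit⟩ := hA.exists_digit_eq (d := fun i => A.rank (f i)) fun i hi =>
    (rank_lt_card (hf.1 hi)).le
  refine ⟨N, hN, funext fun i => ?_⟩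
  by_cases hi : i ∈ A.cover
  · rw [mapOfCode, if_pos hi, hdigit i hi, ofRank_rank (hf.1 hi)]
  · rw [mapOfCode, if_neg hi, hf.2 i hi]

theorem HasPlaceValues.exists_setOfCode_eq (hA : A.HasPlaceValues) {X : Finset ℕ}
    (hX : X ⊆ A.cover) : ∃ N < A.numCodes, A.setOfCode N = X := by
  obtain ⟨N, hN, hdigit⟩ := hA.exists_digit_eq (d := fun i => if i ∈ X then 1 else 0)
    fun i hi => by split <;> have := rank_lt_card hi <;> lia
  refine ⟨N, hN, Finset.ext fun i => ?_⟩
  refine Finset.mem_filter.trans ⟨fun ⟨hi, h⟩ => ?_, fun h => ⟨hX h, ?_⟩⟩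
  · by_contra hiX
    simp [hdigit i hi, hiX] at h
  · simp [hdigit i (hX h), h]

theorem HasPlaceValues.forall_subset_cover_iff (hA : A.HasPlaceValues) {P : Finset ℕ → Prop} :
    (∀ X ⊆ A.cover, P X) ↔ ∀ N < A.numCodes, P (A.setOfCode N) := by
  refine ⟨fun h N _ => h _ (Finset.filter_subset _ _), fun h X hX => ?_⟩
  obtain ⟨N, hN, rfl⟩ := hA.exists_setOfCode_eq hX
  exact h N hN

theorem HasPlaceValues.exists_planOfCodes_eq (hA : A.HasPlaceValues) {p : Plan ℕ}
    (hp : p.IsOn A.cover) : ∃ N, (∀ k, N k < A.numCodes) ∧ A.planOfCodes N = p := by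
  obtain ⟨root, hroot, hroot_eq⟩ := hA.exists_mapOfCode_eq hp.root
  obtain ⟨up, hup, hup_eq⟩ := hA.exists_mapOfCode_eq hp.up
  obtain ⟨grp, hgrp, hgrp_eq⟩ := hA.exists_mapOfCode_eq hp.grp
  obtain ⟨lone, hlone, hlone_eq⟩ := hA.exists_setOfCode_eq hp.lone
  refine ⟨![root, up, grp, lone], fun k => by fin_cases k <;> assumption, ?_⟩
  simp [planOfCodes, hroot_eq, hup_eq, hgrp_eq, hlone_eq]

/-- The partitioned graph in the memory has a connecting subgraph with at most `l` edges. -/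
def HasForest (A : Memory) (l : ℕ) : Prop :=
  ∃ H ≤ A.graph, A.partitionedGraph.Connects H ∧ H.edgeSet.ncard ≤ l

/-- There are codes of a valid plan that has cost at most `l`.  For the conditions on sets, only
sets with codes are taken into account. -/
def HasPlanCodes (A : Memory) (l : ℕ) : Prop :=
  ∃ N : Fin 4 → ℕ, (∀ k, N k < A.numCodes) ∧
    ((A.planOfCodes N).IsConsistent A.partitionedGraph ∧
      (∀ N' < A.numCodes, (A.planOfCodes N).Leaves (A.setOfCode N')) ∧
      ∀ N' < A.numCodes, (A.planOfCodes N).HallAt A.partitionedGraph (A.setOfCode N')) ∧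
    (A.planOfCodes N).cost A.partitionedGraph ≤ l

theorem HasPlaceValues.isValid_iff (hA : A.HasPlaceValues) {p : Plan ℕ} :
    p.IsValid A.partitionedGraph ↔ p.IsConsistent A.partitionedGraph ∧
      (∀ N < A.numCodes, p.Leaves (A.setOfCode N)) ∧
        ∀ N < A.numCodes, p.HallAt A.partitionedGraph (A.setOfCode N) := by
  rw [← hA.forall_subset_cover_iff, ← hA.forall_subset_cover_iff]
  exact ⟨fun h => ⟨h.toIsConsistent, h.leaves, h.hallAt⟩, fun ⟨h, hl, hh⟩ => ⟨h, hl, hh⟩⟩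

theorem HasPlaceValues.hasPlanCodes_iff (hA : A.HasPlaceValues) (hD : A.partitionedGraph.IsProper)
    (l : ℕ) : A.HasPlanCodes l ↔ A.HasForest l := by
  refine Iff.trans ?_ (PartitionedGraph.exists_plan_iff hD
    (plans := {p | ∃ N : Fin 4 → ℕ, (∀ k, N k < A.numCodes) ∧ A.planOfCodes N = p})
    (fun _ => hA.exists_planOfCodes_eq) l)
  constructor
  · rintro ⟨N, hN, hvalid, hcost⟩
    exact ⟨_, ⟨N, hN, rfl⟩, hA.isValid_iff.2 hvalid, hcost⟩
  · rintro ⟨_, ⟨N, hN, rfl⟩, hvalid, hcost⟩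
    exact ⟨N, hN, hA.isValid_iff.1 hvalid, hcost⟩

end Memory

section PolyTime

open Memory

variable {V : Type} [VarTuple V] {f g : V → Memory → ℕ}

theorem PolyTime.edgeCell (hf : PolyTime f) (hg : PolyTime g) :
    PolyTime fun v A => A.edgeCell (f v A) (g v A) :=
  .add (.read 4 (.const 0)) (.add (.mul .order hf) hg)

namespace PolyTimePred

theorem adj (hf : PolyTime f) (hg : PolyTime g) :
    PolyTimePred fun v A => A.graph.Adj (f v A) (g v A) :=
  .and (.not (.eq hf hg)) (.and (.and (.lt hf .order) (.lt hg .order))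
    (.and (.ne_zero (.read 0 (.edgeCell hf hg))) (.ne_zero (.read 0 (.edgeCell hg hf)))))

theorem mem_cover (hf : PolyTime f) : PolyTimePred fun v A => f v A ∈ A.cover :=
  (and (.lt hf .order) (.ne_zero (.read 5 hf))).of_iff fun v A => by simp [cover]

theorem exists_mem_cover {R : V × ℕ → Memory → Prop} (hR : PolyTimePred R) :
    PolyTimePred fun v A => ∃ i ∈ A.cover, R (v, i) A :=
  (exists_lt .order (.and (mem_cover .last) hR)).of_iff fun _ _ =>
    exists_congr fun _ => (and_iff_right_of_imp fun h => lt_order_of_mem_cover h.1).symm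

theorem forall_mem_cover {R : V × ℕ → Memory → Prop} (hR : PolyTimePred R) :
    PolyTimePred fun v A => ∀ i ∈ A.cover, R (v, i) A :=
  (exists_mem_cover hR.not).not.of_iff fun v A => by simp

theorem exists_mem_verts {R : V × ℕ → Memory → Prop} (hR : PolyTimePred R) :
    PolyTimePred fun v A => ∃ u ∈ A.partitionedGraph.verts, R (v, u) A :=
  (exists_lt .order hR).of_iff fun v A => by simp [partitionedGraph]

theorem forall_mem_verts {R : V × ℕ → Memory → Prop} (hR : PolyTimePred R) :
    PolyTimePred fun v A => ∀ u ∈ A.partitionedGraph.verts, R (v, u) A :=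
  (exists_mem_verts hR.not).not.of_iff fun v A => by simp

theorem isTerminal (hf : PolyTime f) :
    PolyTimePred fun v A => A.partitionedGraph.IsTerminal (f v A) :=
  (and (.lt hf .order) (exists_mem_verts
    (and (.not (.eq .last hf.weaken)) (.eq (.read 6 .last) (.read 6 hf.weaken))))).of_iff
    fun v A => by simp [PartitionedGraph.IsTerminal, partitionedGraph]

end PolyTimePred

namespace PolyTime

theorem card_filter_cover {R : V × ℕ → Memory → Prop} [∀ v A, Decidable (R v A)]
    (hR : PolyTimePred R) : PolyTime fun v A => (A.cover.filter fun i => R (v, i) A).card := by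
  simp only [cover, Finset.filter_filter]
  exact card_filter .order (.and (.ne_zero (.read 5 .last)) hR)

theorem card_filter_verts {R : V × ℕ → Memory → Prop} [∀ v A, Decidable (R v A)]
    (hR : PolyTimePred R) :
    PolyTime fun v A => (A.partitionedGraph.verts.filter fun u => R (v, u) A).card :=
  card_filter .order hR

theorem card_cover : PolyTime fun (_ : V) A => A.cover.card :=
  card_filter .order (.ne_zero (.read 5 .last))

theorem rank (hf : LoopRange f) : PolyTime fun v A => A.rank (f v A) :=
  card_filter hf (.mem_cover .last)

theorem ofRank (hf : PolyTime f) : PolyTime fun v A => A.ofRank (f v A) :=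
  sum .order (ite (.and (.mem_cover .last) (.eq (rank .last) hf.weaken)) .last (.const 0))

theorem digit (hf : LoopRange f) (hg : PolyTime g) :
    PolyTime fun v A => A.digit (f v A) (g v A) :=
  mod (hf.div (.read 7 hg)) (add card_cover (.const 1))

theorem mapOfCode (hf : LoopRange f) (hg : PolyTime g) :
    PolyTime fun v A => A.mapOfCode (f v A) (g v A) :=
  ite (.mem_cover hg) (ofRank (digit hf hg)) hg

end PolyTime

namespace PolyTimePred

theorem mem_setOfCode (hf : LoopRange f) (hg : PolyTime g) :
    PolyTimePred fun v A => g v A ∈ A.setOfCode (f v A) :=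
  (and (mem_cover hg) (ne_zero (.digit hf hg))).of_iff fun _ _ => Finset.mem_filter

theorem forall_mem_setOfCode {R : V × ℕ → Memory → Prop} (hf : LoopRange f)
    (hR : PolyTimePred R) : PolyTimePred fun v A => ∀ i ∈ A.setOfCode (f v A), R (v, i) A :=
  (forall_mem_cover (imp (mem_setOfCode hf.weaken .last) hR)).of_iff fun _ _ =>
    forall_congr' fun _ => ⟨fun h _ => h, fun h hi => h (Finset.mem_filter.1 hi).1 hi⟩

theorem exists_mem_setOfCode {R : V × ℕ → Memory → Prop} (hf : LoopRange f)
    (hR : PolyTimePred R) : PolyTimePred fun v A => ∃ i ∈ A.setOfCode (f v A), R (v, i) A :=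
  (forall_mem_setOfCode hf hR.not).not.of_iff fun v A => by simp

variable {N : V → Memory → Fin 4 → ℕ}

theorem usesHub (hN : ∀ k, LoopRange fun v A => N v A k) (hf : PolyTime f) :
    PolyTimePred fun v A => (A.planOfCodes (N v A)).UsesHub A.partitionedGraph (f v A) :=
  .and (mem_cover hf) (.and (.not (.eq (.mapOfCode (hN 0) hf) hf))
    (.not (adj hf (.mapOfCode (hN 1) hf))))

theorem isGroup (hN : ∀ k, LoopRange fun v A => N v A k) (hf : PolyTime f) :
    PolyTimePred fun v A => (A.planOfCodes (N v A)).IsGroup A.partitionedGraph (f v A) :=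
  (exists_mem_cover (.and (usesHub (fun k => (hN k).weaken) .last)
    (.eq (.mapOfCode (hN 2).weaken .last) hf.weaken))).of_iff fun _ _ =>
    exists_congr fun _ => (and_iff_right_of_imp fun h => h.1.1).symm

theorem fits (hN : ∀ k, LoopRange fun v A => N v A k) (hf : PolyTime f) (hg : PolyTime g) :
    PolyTimePred fun v A =>
      (A.planOfCodes (N v A)).Fits A.partitionedGraph (f v A) (g v A) :=
  forall_mem_verts <| .imp (.eq (.read 6 .last) hf.weaken) <|
    .or (.and (mem_cover .last) (.eq (.mapOfCode (hN 0).weaken .last) hg.weaken)) <|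
    .and (.not (mem_cover .last)) <| exists_mem_cover <| .and (adj (.weaken .last) .last)
      (.eq (.mapOfCode (hN 0).weaken.weaken .last) hg.weaken.weaken)

theorem supplies (hN : ∀ k, LoopRange fun v A => N v A k) (hf : PolyTime f) (hg : PolyTime g) :
    PolyTimePred fun v A =>
      (A.planOfCodes (N v A)).Supplies A.partitionedGraph (f v A) (g v A) := by
  have hhub : PolyTimePred fun v A => ∀ i ∈ A.cover,
      (A.planOfCodes (N v A)).UsesHub A.partitionedGraph i →
      (A.planOfCodes (N v A)).grp i = g v A → ∃ w ∈ A.partitionedGraph.verts,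
        A.partitionedGraph.cls w = f v A ∧ A.graph.Adj w i ∧
          A.graph.Adj w ((A.planOfCodes (N v A)).up i) :=
    forall_mem_cover <| .imp (usesHub (fun k => (hN k).weaken) .last) <|
      .imp (.eq (.mapOfCode (hN 2).weaken .last) hg.weaken) <| exists_mem_verts <|
      .and (.eq (.read 6 .last) hf.weaken.weaken) <| .and (adj .last (.weaken .last))
        (adj .last (.weaken (.mapOfCode (hN 1).weaken .last)))
  have hterminal : PolyTimePred fun v A => g v A ∉ A.setOfCode (N v A 3) →
      ∃ u ∈ A.partitionedGraph.verts,
        A.partitionedGraph.IsTerminal u ∧ A.partitionedGraph.cls u = f v A :=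
    .imp (.not (mem_setOfCode (hN 3) hg)) <| exists_mem_verts <|
      .and (isTerminal .last) (.eq (.read 6 .last) hf.weaken)
  refine (and (fits hN hf (.mapOfCode (hN 0) hg)) (and hterminal hhub)).of_iff fun v A =>
    ⟨fun h => ⟨h.fits, fun hl => ?_, fun i _ => h.hub i⟩,
      fun ⟨hfits, hterminal, hhub⟩ => ⟨hfits, fun hl => ?_, fun i hi => hhub i hi.1 hi⟩⟩
  · obtain ⟨u, hu⟩ := h.terminal hl
    exact ⟨u, hu.1.1, hu⟩
  · obtain ⟨u, -, hu⟩ := hterminal hl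
    exact ⟨u, hu⟩

theorem leaves (hN : ∀ k, LoopRange fun v A => N v A k) (hf : LoopRange f) :
    PolyTimePred fun v A => (A.planOfCodes (N v A)).Leaves (A.setOfCode (f v A)) :=
  (imp (exists_mem_setOfCode hf (.mem_setOfCode hf.weaken .last)) <|
    .imp (forall_mem_setOfCode hf (.not (.eq (.mapOfCode (hN 0).weaken .last) .last))) <|
    exists_mem_setOfCode hf <| .not <|
      mem_setOfCode hf.weaken (.mapOfCode (hN 1).weaken .last)).of_iff
    fun v A => by simp [Plan.Leaves, planOfCodes, Finset.Nonempty]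

open Classical in
theorem hallAt (hN : ∀ k, LoopRange fun v A => N v A k) (hf : LoopRange f) :
    PolyTimePred fun v A =>
      (A.planOfCodes (N v A)).HallAt A.partitionedGraph (A.setOfCode (f v A)) :=
  .imp (forall_mem_setOfCode hf (isGroup (fun k => (hN k).weaken) .last)) <|
    .le (.card_filter_cover (ne_zero (.digit hf.weaken .last))) <|
    .card_filter_verts <| exists_mem_setOfCode hf.weaken <|
      supplies (fun k => (hN k).weaken.weaken) (.weaken .last) .last

theorem isConsistent (hN : ∀ k, LoopRange fun v A => N v A k) :
    PolyTimePred fun v A => (A.planOfCodes (N v A)).IsConsistent A.partitionedGraph := by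
  have hmap (k : Fin 4) : PolyTime fun (v : V × ℕ) A => A.mapOfCode (N v.1 A k) v.2 :=
    .mapOfCode (hN k).weaken .last
  have hroot {f : V × ℕ → Memory → ℕ} (hf : PolyTime f) : PolyTimePred fun v A =>
      (A.planOfCodes (N v.1 A)).root (f v A) = (A.planOfCodes (N v.1 A)).root v.2 :=
    .eq (.mapOfCode (hN 0).weaken hf) (hmap 0)
  have hhub : PolyTimePred fun (v : V × ℕ) A =>
      (A.planOfCodes (N v.1 A)).UsesHub A.partitionedGraph v.2 :=
    usesHub (fun k => (hN k).weaken) .last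
  have hterminal : PolyTimePred fun v A => ∀ u ∈ A.partitionedGraph.verts,
      A.partitionedGraph.IsTerminal u → ∃ b ∈ A.partitionedGraph.verts,
        (A.planOfCodes (N v A)).Fits A.partitionedGraph (A.partitionedGraph.cls u) b :=
    forall_mem_verts <| .imp (isTerminal .last) <| exists_mem_verts <|
      fits (fun k => (hN k).weaken.weaken) (.read 6 (.weaken .last)) .last
  exact (and (forall_mem_cover (mem_cover (hmap 1))) <| .and (forall_mem_cover (hroot (hmap 1))) <|
    .and (forall_mem_cover (imp hhub (mem_cover (hmap 2)))) <|
    .and (forall_mem_cover (imp hhub (hroot (hmap 2)))) hterminal).of_iff fun v A =>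
      ⟨fun ⟨h₁, h₂, h₃, h₄, h₅⟩ => ⟨h₁, h₂, h₃, h₄, h₅⟩,
        fun ⟨h₁, h₂, h₃, h₄, h₅⟩ => ⟨h₁, h₂, h₃, h₄, h₅⟩⟩

end PolyTimePred

open Classical in
theorem PolyTime.cost {N : V → Memory → Fin 4 → ℕ} (hN : ∀ k, LoopRange fun v A => N v A k) :
    PolyTime fun v A => (A.planOfCodes (N v A)).cost A.partitionedGraph := by
  have hroot : PolyTimePred fun (v : V × ℕ) A => (A.planOfCodes (N v.1 A)).root v.2 ≠ v.2 :=
    .not (.eq (.mapOfCode (hN 0).weaken .last) .last)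
  have hterminal : PolyTimePred fun (v : V × ℕ) A =>
      v.2 ∉ A.partitionedGraph.cover ∧ A.partitionedGraph.IsTerminal v.2 :=
    .and (.not (.mem_cover .last)) (.isTerminal .last)
  have hlone : PolyTimePred fun (v : V × ℕ) A =>
      (A.planOfCodes (N v.1 A)).IsGroup A.partitionedGraph v.2 ∧ v.2 ∈ A.setOfCode (N v.1 A 3) :=
    .and (.isGroup (fun k => (hN k).weaken) .last) (.mem_setOfCode (hN 3).weaken .last)
  simp only [Plan.cost]
  convert ((card_filter_cover hroot).add (card_filter_verts hterminal)).add
    (card_filter_cover hlone) <;> rfl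

theorem PolyTimePred.exists_codes {R : V → Memory → (Fin 4 → ℕ) → Prop}
    (hR : PolyTimePred fun (v : (((V × ℕ) × ℕ) × ℕ) × ℕ) A =>
      R v.1.1.1.1 A ![v.1.1.1.2, v.1.1.2, v.1.2, v.2]) :
    PolyTimePred fun v A => ∃ N : Fin 4 → ℕ, (∀ k, N k < A.numCodes) ∧ R v A N := by
  refine (exists_lt .numCodes <| exists_lt .numCodes <| exists_lt .numCodes <|
    exists_lt .numCodes hR).of_iff fun v A => ⟨fun ⟨N, hN, h⟩ => ?_, ?_⟩
  · refine ⟨N 0, hN 0, N 1, hN 1, N 2, hN 2, N 3, hN 3, ?_⟩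
    convert h using 1
    ext k
    fin_cases k <;> rfl
  · rintro ⟨a, ha, b, hb, c, hc, d, hd, h⟩
    exact ⟨![a, b, c, d], fun k => by fin_cases k <;> assumption, h⟩

theorem PolyTimePred.hasPlanCodes (hf : PolyTime f) :
    PolyTimePred fun v A => A.HasPlanCodes (f v A) := by
  have hN (k : Fin 4) : LoopRange fun (v : (((V × ℕ) × ℕ) × ℕ) × ℕ) (_ : Memory) =>
      ![v.1.1.1.2, v.1.1.2, v.1.2, v.2] k := by
    fin_cases k
    exacts [LoopRange.last.weaken.weaken.weaken, LoopRange.last.weaken.weaken,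
      LoopRange.last.weaken, LoopRange.last]
  exact exists_codes <| .and (.and (isConsistent hN) (.and
    (forall_lt .numCodes (leaves (fun k => (hN k).weaken) .last))
    (forall_lt .numCodes (hallAt (fun k => (hN k).weaken) .last))))
    (.le (.cost hN) hf.weaken.weaken.weaken.weaken)

end PolyTime

end RAM

/-! ### Preparing the memory -/

theorem eqvGen_relabel {V : Type} {R R' : V → V → Prop} {f : V → ℕ} {i j : V}
    (hf : ∀ u v, f u = f v ↔ Relation.EqvGen R u v)
    (hR : ∀ a b, R' a b ↔ R a b ∨ (a = i ∧ b = j)) (u v : V) :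
    ((if f u = f i then f j else f u) = if f v = f i then f j else f v) ↔
      Relation.EqvGen R' u v := by
  have hmono {a b} (h : f a = f b) : Relation.EqvGen R' a b :=
    ((hf a b).1 h).mono fun _ _ h' => (hR _ _).2 (.inl h')
  have hij : Relation.EqvGen R' i j := .rel _ _ ((hR i j).2 (.inr ⟨rfl, rfl⟩))
  constructor
  · intro h
    split_ifs at h with hu hv hv
    · exact hmono (hu.trans hv.symm)
    · exact (hmono hu).trans _ _ _ (hij.trans _ _ _ (hmono h))
    · exact (hmono h).trans _ _ _ ((hij.symm _ _).trans _ _ _ (hmono hv.symm))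
    · exact hmono h
  · intro h
    induction h with
    | rel a b h =>
      rcases (hR a b).1 h with h | ⟨rfl, rfl⟩
      · rw [(hf a b).2 (.rel _ _ h)]
      · simp
    | refl => rfl
    | symm _ _ _ ih => exact ih.symm
    | trans _ _ _ _ _ ih ih' => exact ih.trans ih'

namespace RAM

/-- The memory after the transformations `F u v`, for all pairs of vertices. -/
def forPairs (F : ℕ → ℕ → Memory → Memory) (A : Memory) : Memory :=
  forLoop (fun u B => forLoop (F u) B.order B) A.order A

/-- The memory after storing `f k` in cell `k` of array `a`, for all vertices `k`. -/
def fill (a : ℕ) (f : ℕ → Memory → ℕ) (A : Memory) : Memory :=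
  forLoop (fun k B => B.set a k (f k B)) A.order A

namespace PolyTimeMap

variable {V : Type} [VarTuple V]

theorem forPairs {F : V → ℕ → ℕ → Memory → Memory}
    (hF : PolyTimeMap fun (v : (V × ℕ) × ℕ) => F v.1.1 v.1.2 v.2) :
    PolyTimeMap fun v => forPairs (F v) :=
  .forLoop .order (.forLoop .order hF)

theorem fill (a : ℕ) {f : V → ℕ → Memory → ℕ} (hf : PolyTime fun (v : V × ℕ) => f v.1 v.2)
    (h2 : a ≠ 2 := by decide) (h3 : a ≠ 3 := by decide) : PolyTimeMap fun v => fill a (f v) :=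
  .forLoop .order (.set a .last hf h2 h3)

end PolyTimeMap

section Loops

variable {A B : Memory} {X : Set ℕ} {a i v : ℕ}

theorem Memory.eqOn_set (h : a ∉ X) : X.EqOn (A.set a i v) A := fun _ hb =>
  Memory.set_apply_of_ne (by rintro rfl; exact h hb) i v

theorem eqOn_forLoop {F : ℕ → Memory → Memory} (h : ∀ i B, X.EqOn (F i B) B) (len : ℕ) :
    X.EqOn (forLoop F len A) A :=
  forLoop_induction (fun _ B => X.EqOn B A) len (fun _ _ => rfl) fun i _ B hB => (h i B).trans hB

theorem eqOn_forPairs {F : ℕ → ℕ → Memory → Memory} (h : ∀ u v B, X.EqOn (F u v B) B) :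
    X.EqOn (forPairs F A) A :=
  eqOn_forLoop (fun u _ => eqOn_forLoop (h u) _) _

theorem eqOn_fill {f : ℕ → Memory → ℕ} (h : a ∉ X) : X.EqOn (fill a f A) A :=
  eqOn_forLoop (fun _ _ => Memory.eqOn_set h) _

theorem fill_apply {f : ℕ → Memory → ℕ} {k : ℕ} (hk : k < A.order)
    (hf : ∀ k B, ({a}ᶜ : Set ℕ).EqOn B A → f k B = f k A) : fill a f A a k = f k A := by
  refine (forLoop_induction (fun len B => ({a}ᶜ : Set ℕ).EqOn B A ∧ ∀ k < len, B a k = f k A)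
    A.order ⟨fun _ _ => rfl, by simp⟩ fun i _ B ⟨hB, hlt⟩ =>
    ⟨(Memory.eqOn_set (by simp)).trans hB, fun k hk => ?_⟩).2 k hk
  rw [Memory.set_apply]
  split_ifs with h
  · rw [h.2, hf i B hB]
  · exact hlt k (by lia)

theorem forPairs_induction {F : ℕ → ℕ → Memory → Memory} (P : Set (ℕ × ℕ) → Memory → Prop)
    (order_eq : ∀ T B, P T B → B.order = A.order) (empty : P ∅ A)
    (insert : ∀ u < A.order, ∀ v < A.order, ∀ T B, P T B → P (insert (u, v) T) (F u v B)) :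
    P {p | p.1 < A.order ∧ p.2 < A.order} (forPairs F A) := by
  refine forLoop_induction (fun i => P {p | p.1 < i ∧ p.2 < A.order}) A.order
    (by simpa using empty) fun i hi B hB => ?_
  rw [order_eq _ _ hB]
  have hrow := forLoop_induction (F := F i)
    (fun j => P ({p | p.1 < i ∧ p.2 < A.order} ∪ {p | p.1 = i ∧ p.2 < j})) A.order
    (by simpa using hB) fun j hj C hC => ?_
  · convert hrow using 1
    ext p
    simp only [Set.mem_union, Set.mem_ofPred_eq]
    lia
  · convert insert i hi j hj _ _ hC using 1
    ext ⟨x, y⟩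
    simp only [Set.mem_union, Set.mem_ofPred_eq, Set.mem_insert_iff, Prod.mk.injEq]
    lia

end Loops

namespace Memory

variable {A B : Memory}

theorem graph_congr (h0 : B 0 = A 0) (h2 : B 2 = A 2) (h4 : B 4 = A 4) : B.graph = A.graph := by
  ext
  simp only [graph, edgeCell, offset, order, h0, h2, h4]

theorem cover_congr (h2 : B 2 = A 2) (h5 : B 5 = A 5) : B.cover = A.cover := by
  simp only [cover, order, h2, h5]

theorem HasPlaceValues.congr (hA : A.HasPlaceValues) (h2 : B 2 = A 2) (h3 : B 3 = A 3)
    (h5 : B 5 = A 5) (h7 : B 7 = A 7) : B.HasPlaceValues := by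
  have hC : B.cover = A.cover := cover_congr h2 h5
  refine ⟨fun i hi => ?_, ?_⟩
  · simpa only [rank, hC, h7] using hA.placeValue i (hC ▸ hi)
  · simpa only [numCodes, hC, h3] using hA.numCodes_eq

open Classical in
/-- Both ends of every edge that is not yet covered are added to the cover, one edge after the
other. -/
noncomputable def markCover (A : Memory) : Memory :=
  forPairs (fun u v B => if B.graph.Adj u v ∧ u ∉ B.cover ∧ v ∉ B.cover then
    (B.set 5 u 1).set 5 v 1 else B) A

theorem eqOn_markCover : ({5}ᶜ : Set ℕ).EqOn A.markCover A :=
  eqOn_forPairs fun u v B => by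
    split_ifs
    exacts [(eqOn_set (by simp)).trans (eqOn_set (by simp)), fun _ _ => rfl]

theorem cover_set {u : ℕ} (hu : u < A.order) : (A.set 5 u 1).cover = insert u A.cover := by
  ext w
  simp only [cover, order_set (show (5 : ℕ) ≠ 2 by decide), set_apply, Finset.mem_filter,
    Finset.mem_insert, Finset.mem_range]
  split_ifs <;> grind

theorem cover_set_set {u v : ℕ} (hu : u < A.order) (hv : v < A.order) :
    ((A.set 5 u 1).set 5 v 1).cover = insert v (insert u A.cover) := by
  rw [cover_set (by rwa [order_set (by decide)]), cover_set hu]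

theorem mem_cover_markCover_or {u v : ℕ} (h : A.graph.Adj u v) :
    u ∈ A.markCover.cover ∨ v ∈ A.markCover.cover := by
  classical
  refine (forPairs_induction (fun T B => ({5}ᶜ : Set ℕ).EqOn B A ∧ ∀ p ∈ T,
    A.graph.Adj p.1 p.2 → p.1 ∈ B.cover ∨ p.2 ∈ B.cover)
    (fun T B h => congrFun (h.1 (by simp)) 0) ⟨fun _ _ => rfl, by simp⟩
    fun u hu v hv T B ⟨hB, hT⟩ => ?_).2 (u, v) h.2.1 h
  have hadj : B.graph = A.graph := graph_congr (hB (by simp)) (hB (by simp)) (hB (by simp))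
  have horder : B.order = A.order := congrFun (hB (by simp)) 0
  split_ifs with huv
  · refine ⟨(eqOn_set (by simp)).trans ((eqOn_set (by simp)).trans hB), ?_⟩
    rw [cover_set_set (horder ▸ hu) (horder ▸ hv)]
    grind
  · refine ⟨hB, ?_⟩
    rintro p (rfl | hp) h
    · rw [hadj] at huv
      tauto
    · exact hT p hp h

theorem card_cover_markCover_le (hA : A 5 = 0) {D : Finset ℕ}
    (hD : ∀ u v, A.graph.Adj u v → u ∈ D ∨ v ∈ D) : A.markCover.cover.card ≤ 2 * D.card := by
  classical
  have hmatched : A.markCover.cover.card ≤ 2 * (A.markCover.cover ∩ D).card := by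
    refine (forPairs_induction (fun _ B => ({5}ᶜ : Set ℕ).EqOn B A ∧
      B.cover.card ≤ 2 * (B.cover ∩ D).card) (fun T B h => congrFun (h.1 (by simp)) 0)
      ⟨fun _ _ => rfl, by simp [cover, hA]⟩ fun u hu v hv T B ⟨hB, hle⟩ => ?_).2
    have hadj : B.graph = A.graph := graph_congr (hB (by simp)) (hB (by simp)) (hB (by simp))
    have horder : B.order = A.order := congrFun (hB (by simp)) 0
    split_ifs with huv
    · refine ⟨(eqOn_set (by simp)).trans ((eqOn_set (by simp)).trans hB), ?_⟩
      obtain ⟨huv, hu', hv'⟩ := huv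
      rw [cover_set_set (horder ▸ hu) (horder ▸ hv),
        Finset.card_insert_of_notMem (by simp [huv.ne', hv']), Finset.card_insert_of_notMem hu']
      have hlt : (B.cover ∩ D).card < (insert v (insert u B.cover) ∩ D).card :=
        Finset.card_lt_card ((Finset.ssubset_iff_of_subset (by grind)).2 (by
          rcases hD u v (hadj ▸ huv) with h | h
          exacts [⟨u, by simp [h], by simp [hu']⟩, ⟨v, by simp [h], by simp [hv']⟩]))
      lia
    · exact ⟨hB, hle⟩
  exact hmatched.trans (Nat.mul_le_mul_left 2 (Finset.card_le_card Finset.inter_subset_right))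

/-- The position of an entry of the matrix of terminal pairs in array `0`. -/
def pairCell (A : Memory) (u v : ℕ) : ℕ := A.offset + (A.order * A.order + (A.order * u + v))

/-- The classes of `i` and `j` are merged. -/
def mergeClasses (i j : ℕ) (A : Memory) : Memory :=
  fill 6 (fun k B => B 8 k) (fill 8 (fun k B => if B 6 k = B 6 i then B 6 j else B 6 k) A)

/-- The classes of terminals are determined, by merging the classes of every pair. -/
def loadClasses (A : Memory) : Memory :=
  forPairs (fun i j B => if B 0 (B.pairCell i j) ≠ 0 then B.mergeClasses i j else B)
    (fill 6 (fun k _ => k) A)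

/-- Array `6` holds the classes of the equivalence relation that is generated by `R`. -/
structure HasClasses {n : ℕ} (A : Memory) (R : Fin n → Fin n → Prop) : Prop where
  order_eq : A.order = n
  cls_lt : ∀ u : Fin n, A 6 u < n
  cls_eq_iff : ∀ u v : Fin n, A 6 u = A 6 v ↔ Relation.EqvGen R u v

theorem eqOn_mergeClasses {i j : ℕ} : ({6, 8}ᶜ : Set ℕ).EqOn (A.mergeClasses i j) A :=
  (eqOn_fill (by simp)).trans (eqOn_fill (by simp))

theorem eqOn_loadClasses : ({6, 8}ᶜ : Set ℕ).EqOn A.loadClasses A :=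
  (eqOn_forPairs fun i j B => by split_ifs; exacts [eqOn_mergeClasses, fun _ _ => rfl]).trans
    (eqOn_fill (by simp))

theorem mergeClasses_apply {i j k : ℕ} (hk : k < A.order) :
    A.mergeClasses i j 6 k = if A 6 k = A 6 i then A 6 j else A 6 k := by
  set B := fill 8 (fun k B => if B 6 k = B 6 i then B 6 j else B 6 k) A with hB
  have horder : B.order = A.order :=
    congrFun (eqOn_fill (X := {8}ᶜ) (by simp) (show (2 : ℕ) ∈ _ by simp)) 0
  rw [mergeClasses, ← hB, fill_apply (horder ▸ hk) fun k C hC => by rw [hC (by simp)], hB,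
    fill_apply hk fun k C hC => by rw [hC (by simp)]]

theorem hasClasses_fill : HasClasses (n := A.order) (fill 6 (fun k _ => k) A) fun _ _ => False := by
  have happly {k : ℕ} (hk : k < A.order) : fill 6 (fun k _ => k) A 6 k = k :=
    fill_apply hk fun _ _ _ => rfl
  refine ⟨congrFun (eqOn_fill (X := {6}ᶜ) (by simp) (by simp)) 0, fun u => ?_, fun u v => ?_⟩
  · exact (happly u.2).trans_lt u.2
  · rw [happly u.2, happly v.2, Fin.val_inj]
    refine ⟨fun h => h ▸ .refl _, fun h => ?_⟩
    induction h with
    | rel _ _ h => exact h.elim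
    | refl => rfl
    | symm _ _ _ ih => exact ih.symm
    | trans _ _ _ _ _ ih ih' => exact ih.trans ih'

theorem HasClasses.mergeClasses {n : ℕ} {R R' : Fin n → Fin n → Prop} (hA : A.HasClasses R)
    {i j : Fin n} (hR : ∀ a b, R' a b ↔ R a b ∨ (a = i ∧ b = j)) :
    (A.mergeClasses i j).HasClasses R' := by
  have happly (k : Fin n) :=
    mergeClasses_apply (i := i) (j := j) (k.2.trans_eq hA.order_eq.symm)
  refine ⟨(congrFun (eqOn_mergeClasses (by simp)) 0).trans hA.order_eq, fun u => ?_, fun u v => ?_⟩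
  · rw [happly]
    split_ifs
    exacts [hA.cls_lt j, hA.cls_lt u]
  · rw [happly, happly]
    exact eqvGen_relabel (f := fun k : Fin n => A 6 k) hA.cls_eq_iff hR u v

theorem HasClasses.congr {n : ℕ} {R : Fin n → Fin n → Prop} (hA : A.HasClasses R)
    (h2 : B 2 = A 2) (h6 : B 6 = A 6) : B.HasClasses R := by
  refine ⟨(congrFun h2 0).trans hA.order_eq, ?_, ?_⟩
  · simpa only [h6] using hA.cls_lt
  · simpa only [h6] using hA.cls_eq_iff

theorem hasClasses_loadClasses {n : ℕ} {R : Fin n → Fin n → Prop} (hn : A.order = n)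
    (hR : ∀ u v : Fin n, A 0 (A.pairCell u v) ≠ 0 ↔ R u v) : A.loadClasses.HasClasses R := by
  subst hn
  obtain rfl : R = fun u v : Fin A.order => A 0 (A.pairCell u v) ≠ 0 := by
    simp only [hR]
  have hfill : ({6, 8}ᶜ : Set ℕ).EqOn (fill 6 (fun k _ => k) A) A := eqOn_fill (by simp)
  have horder : (fill 6 (fun k _ => k) A).order = A.order :=
    congrFun (hfill (show (2 : ℕ) ∈ _ by simp)) 0
  have key := forPairs_induction (A := fill 6 (fun k _ => k) A)
    (F := fun i j B => if B 0 (B.pairCell i j) ≠ 0 then B.mergeClasses i j else B)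
    (fun T B => ({6, 8}ᶜ : Set ℕ).EqOn B A ∧
      B.HasClasses fun a b : Fin A.order => (a.val, b.val) ∈ T ∧ A 0 (A.pairCell a b) ≠ 0)
    (fun T B h => h.2.order_eq.trans horder.symm)
    ⟨hfill, by simpa using hasClasses_fill⟩ fun i hi j hj T B ⟨hB, hcls⟩ => ?_
  · replace key := key.2
    rw [horder] at key
    simpa only [loadClasses, Set.mem_ofPred_eq, Fin.is_lt, and_self, true_and] using key
  · obtain ⟨i, rfl⟩ : ∃ i' : Fin A.order, i'.val = i := ⟨⟨i, horder ▸ hi⟩, rfl⟩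
    obtain ⟨j, rfl⟩ : ∃ j' : Fin A.order, j'.val = j := ⟨⟨j, horder ▸ hj⟩, rfl⟩
    have hcell : B 0 (B.pairCell i j) = A 0 (A.pairCell i j) := by
      simp only [pairCell, offset, order, hB (show (4 : ℕ) ∈ _ by simp),
        hB (show (0 : ℕ) ∈ _ by simp), hB (show (2 : ℕ) ∈ _ by simp)]
    have hmem (a b : Fin A.order) : (a.val, b.val) ∈ insert (i.val, j.val) T ↔
        (a.val, b.val) ∈ T ∨ (a = i ∧ b = j) := by
      simp [Fin.ext_iff, or_comm]
    simp only [hcell, hmem]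
    split_ifs with h
    · exact ⟨eqOn_mergeClasses.trans hB, hcls.mergeClasses fun a b => by grind⟩
    · refine ⟨hB, ?_⟩
      convert hcls using 3 with a b
      exact ⟨fun ⟨hab, h'⟩ => ⟨hab.resolve_right (by rintro ⟨rfl, rfl⟩; exact h h'), h'⟩,
        fun h' => ⟨.inl h'.1, h'.2⟩⟩

end Memory

end RAM

open Classical in
theorem matrixBits_eq_ofFn {n : ℕ} (r : Fin n → Fin n → Prop) :
    matrixBits r = List.ofFn fun k : Fin (n * n) =>
      if r (finProdFinEquiv.symm k).1 (finProdFinEquiv.symm k).2 then 1 else 0 := by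
  have hcell (i j : Fin n) (h : n * i + j < n * n) :
      finProdFinEquiv.symm (⟨n * i + j, h⟩ : Fin (n * n)) = (i, j) := by
    rw [Equiv.symm_apply_eq]
    exact Fin.ext (add_comm _ _)
  simp only [matrixBits, List.ofFn_mul', hcell, List.ofFn_eq_map, List.flatMap_def]

theorem length_matrixBits {n : ℕ} (r : Fin n → Fin n → Prop) : (matrixBits r).length = n * n := by
  rw [matrixBits_eq_ofFn, List.length_ofFn]

open Classical in
theorem getD_matrixBits {n : ℕ} (r : Fin n → Fin n → Prop) (i j : Fin n) :
    (matrixBits r).getD (n * i + j) 0 = if r i j then 1 else 0 := by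
  have hlt : n * i + j < n * n := add_comm (n * (i : ℕ)) j ▸ (finProdFinEquiv (i, j)).2
  have hcell : (⟨n * i + j, hlt⟩ : Fin (n * n)) = finProdFinEquiv (i, j) := Fin.ext (add_comm _ _)
  simp only [matrixBits_eq_ofFn, List.getD_eq_getElem?_getD, List.getElem?_ofFn, hlt, dite_true,
    Option.getD_some, hcell, Equiv.symm_apply_apply]

namespace SteinerInstance

variable (I : SteinerInstance)

open Classical in
theorem getD_encode_adj (u v : Fin I.n) :
    I.encode.getD (1 + (I.n * u + v)) 0 = if I.G.Adj u v then 1 else 0 := by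
  have hlt : I.n * u + v < I.n * I.n := add_comm (I.n * (u : ℕ)) v ▸ (finProdFinEquiv (u, v)).2
  rw [encode, add_comm 1, List.getD_cons_succ, List.getD_append _ _ _ _ (by
    rwa [length_matrixBits]), getD_matrixBits]

open Classical in
theorem getD_encode_pair (u v : Fin I.n) :
    I.encode.getD (1 + (I.n * I.n + (I.n * u + v))) 0 = if (u, v) ∈ I.S then 1 else 0 := by
  rw [encode, add_comm 1, List.getD_cons_succ, List.getD_append_right _ _ _ _ (by
    rw [length_matrixBits]; exact Nat.le_add_right _ _), length_matrixBits, Nat.add_sub_cancel_left,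
    getD_matrixBits]

theorem exists_cover_card :
    ∃ W : Finset (Fin I.n), (∀ u v, I.G.Adj u v → u ∈ W ∨ v ∈ W) ∧ W.card = I.vc := by
  classical
  obtain ⟨s, hs, hcov⟩ := SimpleGraph.vertexCoverNum_exists I.G
  refine ⟨s.toFinset, fun u v h => by simpa using hcov h, ?_⟩
  rw [SteinerInstance.vc, ← hs, Set.encard_eq_coe_toFinset_card, ENat.toNat_natCast]

end SteinerInstance

namespace RAM

theorem getD_append_arr_init (pre x : List ℕ) (k : ℕ) :
    (State.init (pre ++ x)).arr 0 (pre.length + k) = x.getD k 0 := by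
  simp only [State.init, if_true, List.getD_append_right _ _ _ _ (Nat.le_add_right _ _),
    Nat.add_sub_cancel_left]

namespace Memory

variable {A : Memory}

/-- The powers that are needed to access the digits of codes are computed: the number in cell `i`
of array `7` has exponent `rank i`. -/
noncomputable def loadPlaceValues (A : Memory) : Memory :=
  forLoop (fun i B => B.set 7 (i + 1)
    (if i ∈ B.cover then B.cover.card * B 7 i + B 7 i else B 7 i)) A.order (A.set 7 0 1)

theorem eqOn_loadPlaceValues : ({7}ᶜ : Set ℕ).EqOn A.loadPlaceValues A :=
  (eqOn_forLoop (fun _ _ => eqOn_set (by simp)) _).trans (eqOn_set (by simp))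

theorem rank_succ (i : ℕ) : A.rank (i + 1) = if i ∈ A.cover then A.rank i + 1 else A.rank i := by
  rw [rank, Finset.range_add_one, Finset.filter_insert]
  split_ifs with h
  · exact Finset.card_insert_of_notMem (by simp)
  · rfl

theorem loadPlaceValues_apply {i : ℕ} (hi : i ≤ A.order) :
    A.loadPlaceValues 7 i = (A.cover.card + 1) ^ A.rank i := by
  refine (forLoop_induction (fun i B => ({7}ᶜ : Set ℕ).EqOn B A ∧ ∀ j ≤ i,
    B 7 j = (A.cover.card + 1) ^ A.rank j) A.order ⟨eqOn_set (by simp), ?_⟩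
    fun i _ B ⟨hB, hpow⟩ => ⟨(eqOn_set (by simp)).trans hB, fun j hj => ?_⟩).2 i hi
  · simp [set_apply, rank]
  have hC : B.cover = A.cover := cover_congr (hB (by simp)) (hB (by simp))
  rw [set_apply]
  split_ifs with h hmem
  · rw [h.2, hC, hpow i le_rfl, rank_succ, if_pos (hC ▸ hmem), pow_succ]
    ring
  · rw [h.2, hpow i le_rfl, rank_succ, if_neg (hC ▸ hmem)]
  · exact hpow j (by lia)

/-- Array `3` is loaded with the number of maps of the cover into itself, with a provision for
undefined values. -/
def loadNumCodes (A : Memory) : Memory := A.set 3 0 (A 7 A.order)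

theorem hasPlaceValues_loadNumCodes : A.loadPlaceValues.loadNumCodes.HasPlaceValues := by
  set B := A.loadPlaceValues with hB
  have horder : B.order = A.order := congrFun (eqOn_loadPlaceValues (by simp)) 0
  have hC : B.loadNumCodes.cover = A.cover :=
    (cover_congr (set_apply_of_ne (by decide) _ _) (set_apply_of_ne (by decide) _ _)).trans
      (cover_congr (eqOn_loadPlaceValues (by simp)) (eqOn_loadPlaceValues (by simp)))
  refine ⟨fun i hi => ?_, ?_⟩
  · rw [hC] at hi
    rw [loadNumCodes, set_apply_of_ne (by decide), ← loadNumCodes, hC, hB,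
      loadPlaceValues_apply (lt_order_of_mem_cover hi).le, rank, rank, hC]
  · rw [hC, numCodes, loadNumCodes, set_apply, if_pos ⟨rfl, rfl⟩, horder, hB,
      loadPlaceValues_apply le_rfl, rank_order]

/-- The memory on input `x`, after the number of vertices has been read from position `p`, which
the adjacency matrix follows. -/
def load (p : ℕ) (x : List ℕ) : Memory :=
  (Memory.set (State.init x).arr 2 0 ((State.init x).arr 0 p)).set 4 0 (p + 1)

/-- The part of the preparations that takes time polynomial in the number of vertices. -/
noncomputable def prepare (A : Memory) : Memory := A.markCover.loadClasses.loadPlaceValues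

theorem eqOn_loadNumCodes_prepare :
    ({3, 5, 6, 7, 8}ᶜ : Set ℕ).EqOn A.prepare.loadNumCodes A :=
  (eqOn_set (by simp)).trans <| (eqOn_loadPlaceValues.mono (by simp)).trans <|
    (eqOn_loadClasses.mono (by grind)).trans (eqOn_markCover.mono (by simp))

/-- The memory holds the instance `I`, together with a small vertex cover of it and the auxiliary
powers. -/
structure Represents (A : Memory) (I : SteinerInstance) : Prop where
  graph_eq : A.graph = I.G.map Fin.valEmbedding
  hasClasses : A.HasClasses fun u v => (u, v) ∈ I.S
  mem_cover : ∀ {u v}, A.graph.Adj u v → u ∈ A.cover ∨ v ∈ A.cover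
  card_cover_le : A.cover.card ≤ 2 * I.vc
  hasPlaceValues : A.HasPlaceValues

theorem Represents.isProper {I : SteinerInstance} (hA : A.Represents I) :
    A.partitionedGraph.IsProper where
  mem_verts h := Finset.mem_range.2 h.2.1.1
  mem_cover h := hA.mem_cover h
  cover_subset _ hu := Finset.mem_range.2 (lt_order_of_mem_cover hu)
  cls_mem {u} hu := by
    have horder := hA.hasClasses.order_eq
    exact Finset.mem_range.2 ((hA.hasClasses.cls_lt
      ⟨u, (Finset.mem_range.1 hu).trans_eq horder⟩).trans_eq horder.symm)

theorem graph_eq_map {n : ℕ} {G : SimpleGraph (Fin n)} (hn : A.order = n)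
    (hcell : ∀ u v : Fin n, A 0 (A.edgeCell u v) ≠ 0 ↔ G.Adj u v) :
    A.graph = G.map Fin.valEmbedding := by
  ext u v
  rw [SimpleGraph.map_adj]
  simp only [graph, Fin.valEmbedding_apply, hn]
  constructor
  · rintro ⟨-, ⟨hu, hv⟩, h, -⟩
    exact ⟨⟨u, hu⟩, ⟨v, hv⟩, (hcell ⟨u, hu⟩ ⟨v, hv⟩).1 h, rfl, rfl⟩
  · rintro ⟨u, v, h, rfl, rfl⟩
    exact ⟨Fin.val_injective.ne h.ne, ⟨u.2, v.2⟩, (hcell u v).2 h, (hcell v u).2 h.symm⟩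

theorem card_cover_markCover_le_vc {I : SteinerInstance} (hA : A 5 = 0)
    (hG : A.graph = I.G.map Fin.valEmbedding) : A.markCover.cover.card ≤ 2 * I.vc := by
  obtain ⟨W, hW, hcard⟩ := I.exists_cover_card
  refine (card_cover_markCover_le hA (D := W.map Fin.valEmbedding) fun u v h => ?_).trans_eq
    (by rw [Finset.card_map, hcard])
  rw [hG, SimpleGraph.map_adj] at h
  obtain ⟨u, v, h, rfl, rfl⟩ := h
  exact (hW u v h).imp (Finset.mem_map_of_mem _) (Finset.mem_map_of_mem _)

theorem represents_loadNumCodes_prepare {I : SteinerInstance} (horder : A.order = I.n)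
    (hA : A 5 = 0) (hadj : ∀ u v : Fin I.n, A 0 (A.edgeCell u v) ≠ 0 ↔ I.G.Adj u v)
    (hpair : ∀ u v : Fin I.n, A 0 (A.pairCell u v) ≠ 0 ↔ (u, v) ∈ I.S) :
    A.prepare.loadNumCodes.Represents I := by
  have hcls : ({3, 7}ᶜ : Set ℕ).EqOn A.prepare.loadNumCodes A.markCover.loadClasses :=
    (eqOn_set (by simp)).trans (eqOn_loadPlaceValues.mono (by simp))
  have hmark : ({3, 6, 7, 8}ᶜ : Set ℕ).EqOn A.prepare.loadNumCodes A.markCover :=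
    (hcls.mono (by grind)).trans (eqOn_loadClasses.mono (by grind))
  have hgraph : A.prepare.loadNumCodes.graph = A.graph :=
    graph_congr (eqOn_loadNumCodes_prepare (by simp)) (eqOn_loadNumCodes_prepare (by simp))
      (eqOn_loadNumCodes_prepare (by simp))
  have hcover := cover_congr (hmark (by simp)) (hmark (by simp))
  have hmap := graph_eq_map horder hadj
  refine ⟨hgraph.trans hmap, ?_, fun h => ?_, ?_, hasPlaceValues_loadNumCodes⟩
  · refine (hasClasses_loadClasses (A := A.markCover) ?_ fun u v => ?_).congr
      (hcls (by simp)) (hcls (by simp))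
    · exact (congrFun (eqOn_markCover (by simp)) 0).trans horder
    · rw [← hpair, pairCell, offset, order, eqOn_markCover (show (0 : ℕ) ∈ _ by simp),
        eqOn_markCover (show (2 : ℕ) ∈ _ by simp), eqOn_markCover (show (4 : ℕ) ∈ _ by simp)]
      rfl
  · rw [hcover]
    exact mem_cover_markCover_or (hgraph ▸ h)
  · rw [hcover]
    exact card_cover_markCover_le_vc hA hmap

theorem represents_load (pre : List ℕ) (I : SteinerInstance) :
    (load pre.length (pre ++ I.encode)).prepare.loadNumCodes.Represents I := by
  classical
  have hinput (k : ℕ) : load pre.length (pre ++ I.encode) 0 (pre.length + k) =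
      I.encode.getD k 0 := by
    rw [load, set_apply_of_ne (by decide), set_apply_of_ne (by decide), getD_append_arr_init]
  have horder : (load pre.length (pre ++ I.encode)).order = I.n := by
    rw [order, load, set_apply_of_ne (by decide), set_apply, if_pos ⟨rfl, rfl⟩]
    exact getD_append_arr_init pre I.encode 0
  have hoffset : (load pre.length (pre ++ I.encode)).offset = pre.length + 1 := by
    rw [offset, load, set_apply, if_pos ⟨rfl, rfl⟩]
  refine represents_loadNumCodes_prepare horder rfl (fun u v => ?_) fun u v => ?_
  · rw [edgeCell, hoffset, horder, add_assoc, hinput, I.getD_encode_adj]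
    simp
  · rw [pairCell, hoffset, horder, add_assoc, hinput, I.getD_encode_pair]
    simp

end Memory

section PolyTime

variable {V : Type} [VarTuple V] {f g : V → Memory → ℕ}

theorem LoopRange.card_cover : LoopRange fun (_ : V) A => A.cover.card :=
  ⟨.card_cover, fun _ _ _ => Memory.card_cover_le.trans (Nat.le_add_right _ _)⟩

theorem PolyTime.pairCell (hf : PolyTime f) (hg : PolyTime g) :
    PolyTime fun v A => A.pairCell (f v A) (g v A) :=
  .add (.read 4 (.const 0)) (.add (.mul .order .order) (.add (.mul .order hf) hg))

namespace PolyTimeMap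

open Classical in
theorem markCover : PolyTimeMap fun (_ : V) A => A.markCover :=
  .forPairs <| .ite
    (.and (.adj (.weaken .last) .last) (.and (.not (.mem_cover (.weaken .last)))
      (.not (.mem_cover .last))))
    (.comp (.set 5 .last (.const 1)) (.set 5 (.weaken .last) (.const 1))) .id

theorem mergeClasses : PolyTimeMap fun (v : (V × ℕ) × ℕ) A => A.mergeClasses v.1.2 v.2 :=
  .comp (F := fun _ => RAM.fill 8 _) (.fill 6 (.read 8 .last)) <| .fill 8 <| .ite
    (.eq (.read 6 .last) (.read 6 (.weaken (.weaken .last))))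
    (.read 6 (.weaken .last)) (.read 6 .last)

theorem loadClasses : PolyTimeMap fun (_ : V) A => A.loadClasses :=
  .comp (F := fun _ => RAM.fill 6 _)
    (.forPairs <| .ite (.ne_zero (.read 0 (.pairCell (.weaken .last) .last))) .mergeClasses .id)
    (.fill 6 .last)

theorem loadPlaceValues : PolyTimeMap fun (_ : V) A => A.loadPlaceValues :=
  .comp (F := fun _ A => A.set 7 0 1)
    (.forLoop .order <| .set 7 (.add .last (.const 1)) <| .ite (.mem_cover .last)
      (.add (.mul .card_cover (.read 7 .last)) (.read 7 .last)) (.read 7 .last))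
    (.set 7 (.const 0) (.const 1))

theorem prepare : PolyTimeMap fun (_ : V) A => A.prepare :=
  (loadPlaceValues.comp (loadClasses.comp (markCover (V := V))) :)

theorem exists_prog {F : Memory → Memory} (hF : PolyTimeMap fun (_ : Unit) => F) :
    ∃ (P : Prog) (k : ℕ), ∀ (A : Memory) (s : State), s.arr = A →
      P.EndsWithin s (k * (A.size + 1) ^ k) fun s' => s'.arr = F A := by
  obtain ⟨-, T, ⟨k, hk⟩, hprog⟩ := hF
  obtain ⟨P, hP⟩ := hprog 0 [] (by simp)
  refine ⟨P, k, ?_⟩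
  rintro _ s rfl
  exact (hP () s ⟨rfl, by simp [VarTuple.InRange, VarTuple.values]⟩).mono (hk _) fun _ h => h.1

end PolyTimeMap

end PolyTime

namespace Memory

/-- The cells of array `1` that form the output.  Their number is in array `9`. -/
def output (A : Memory) : List ℕ := (List.range (A 9 0)).map (A 1)

theorem size_load_le (p : ℕ) (x : List ℕ) :
    (load p x).size ≤ (load p x).prepare.loadNumCodes.size := by
  have horder : (load p x).prepare.loadNumCodes.order = (load p x).order :=
    congrFun (eqOn_loadNumCodes_prepare (by simp)) 0
  have hzero : (load p x).numCodes = 0 := rfl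
  rw [Memory.size, Memory.size, horder, hzero]
  exact Nat.le_add_right _ _

end Memory

open Memory

theorem exists_prog {G : Memory → Memory} (p : ℕ) (hG : PolyTimeMap fun (_ : Unit) => G) :
    ∃ (P : Prog) (k : ℕ), ∀ x, P.EndsWithin (.init x)
      (k * ((load p x).prepare.loadNumCodes.size + 1) ^ k)
      fun s => s.output = (G (load p x).prepare.loadNumCodes).output := by
  obtain ⟨prep, k, hprep⟩ := PolyTimeMap.prepare.exists_prog
  obtain ⟨main, l, hmain⟩ := hG.exists_prog
  obtain ⟨m, hm⟩ := (PolyBounded.const 15).add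
    (.add (f := fun X => k * (X + 1) ^ k) (g := fun X => l * (X + 1) ^ l) ⟨k, fun _ => le_rfl⟩
      ⟨l, fun _ => le_rfl⟩)
  refine ⟨.seq (.write 2 (.lit 0) (.read 0 (.lit p))) <| .seq (.write 4 (.lit 0) (.lit (p + 1))) <|
    .seq prep <| .seq (.write 3 (.lit 0) (.read 7 (.read 2 (.lit 0)))) <|
    .seq main (.assign 0 (.read 9 (.lit 0))), m, fun x => ?_⟩
  refine ((Prog.EndsWithin.write (Q := fun s =>
      s.arr = Memory.set (State.init x).arr 2 0 ((State.init x).arr 0 p)) rfl).seq fun s₁ h₁ =>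
    (Prog.EndsWithin.write (Q := fun s => s.arr = load p x) ?_).seq fun s₂ h₂ =>
    (hprep _ s₂ h₂).seq fun s₃ h₃ =>
    (Prog.EndsWithin.write (Q := fun s => s.arr = (load p x).prepare.loadNumCodes) ?_).seq
    fun s₄ h₄ => (hmain _ s₄ h₄).seq fun s₅ h₅ => .assign ?_).mono ?_ fun _ h => h
  · simp only [State.setArr, Expr.eval, h₁]
    rfl
  · simp only [State.setArr, Expr.eval, h₃]
    rfl
  · simp [State.output, Memory.output, State.setReg, Expr.eval, h₅]
  · have hle : k * ((load p x).size + 1) ^ k ≤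
        k * ((load p x).prepare.loadNumCodes.size + 1) ^ k := by
      gcongr
      exact size_load_le p x
    refine le_trans ?_ (hm _)
    simp only [Expr.cost]
    lia

end RAM

/-! ### Forests in the memory and Steiner forests -/

section Map

variable {V W : Type*} {f : V ↪ W}

theorem reachable_map_iff {K : SimpleGraph V} {a b : V} :
    (K.map f).Reachable (f a) (f b) ↔ K.Reachable a b := by
  have : Nonempty V := ⟨a⟩
  have hinv := Function.leftInverse_invFun f.injective
  refine ⟨fun h => ?_, fun h => h.map (SimpleGraph.Embedding.map f K).toHom⟩
  have hadj {x y : W} (h : (K.map f).Adj x y) :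
      K.Adj (Function.invFun f x) (Function.invFun f y) := by
    obtain ⟨u, v, huv, rfl, rfl⟩ := (SimpleGraph.map_adj f K x y).1 h
    rwa [hinv u, hinv v]
  have hreach := h.map (⟨Function.invFun f, hadj⟩ : K.map f →g K)
  change K.Reachable (Function.invFun f (f a)) (Function.invFun f (f b)) at hreach
  rwa [hinv a, hinv b] at hreach

theorem exists_map_eq_of_le_map {G : SimpleGraph V} {H : SimpleGraph W} (h : H ≤ G.map f) :
    ∃ K ≤ G, K.map f = H := by
  refine ⟨H.comap f, (SimpleGraph.comap_monotone f h).trans_eq (SimpleGraph.comap_map_eq f G),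
    (SimpleGraph.map_comap_le f H).antisymm fun x y hxy => ?_⟩
  obtain ⟨u, v, -, rfl, rfl⟩ := (SimpleGraph.map_adj f G x y).1 (h hxy)
  exact (SimpleGraph.map_adj f _ _ _).2 ⟨u, v, hxy, rfl, rfl⟩

theorem ncard_edgeSet_map {K : SimpleGraph V} : (K.map f).edgeSet.ncard = K.edgeSet.ncard := by
  rw [SimpleGraph.edgeSet_map]
  exact Set.ncard_image_of_injective _ f.sym2Map.injective

end Map

/-- The members of every pair in `S` are connected in `H`. -/
def ConnectsPairs {V : Type} (S : Set (V × V)) (H : SimpleGraph V) : Prop :=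
  ∀ p ∈ S, H.Reachable p.1 p.2

section ConnectsPairs

variable {V : Type} {G H : SimpleGraph V} {S : Set (V × V)}

theorem IsSteinerForest.connectsPairs {F : G.Subgraph} (h : IsSteinerForest S F) :
    ConnectsPairs S F.spanningCoe := by
  intro p hp
  obtain ⟨h₁, h₂, h⟩ := h p hp
  exact h.map (⟨Subtype.val, fun hab => hab⟩ : F.coe →g F.spanningCoe)

theorem ConnectsPairs.isSteinerForest (h : ConnectsPairs S H) (hH : H ≤ G) :
    IsSteinerForest S (SimpleGraph.toSubgraph H hH) := fun p hp =>
  ⟨trivial, trivial, (h p hp).map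
    (⟨fun v => ⟨v, trivial⟩, fun hab => hab⟩ : H →g (SimpleGraph.toSubgraph H hH).coe)⟩

theorem ConnectsPairs.reachable_of_eqvGen (hH : ConnectsPairs S H) {u v : V}
    (h : Relation.EqvGen (fun a b => (a, b) ∈ S) u v) : H.Reachable u v := by
  induction h with
  | rel a b h => exact hH _ h
  | refl => exact .refl _
  | symm _ _ _ ih => exact ih.symm
  | trans _ _ _ _ _ ih ih' => exact ih.trans ih'

theorem edgeSet_toSubgraph (hH : H ≤ G) : (SimpleGraph.toSubgraph H hH).edgeSet = H.edgeSet := by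
  ext e
  induction e
  rfl

end ConnectsPairs

theorem SteinerInstance.hasSteinerForestOfSize_iff {I : SteinerInstance} {l : ℕ} :
    I.HasSteinerForestOfSize l ↔
      ∃ K ≤ I.G, ConnectsPairs I.S K ∧ K.edgeSet.ncard ≤ l := by
  constructor
  · rintro ⟨F, hF, hl⟩
    exact ⟨F.spanningCoe, F.spanningCoe_le, hF.connectsPairs, by
      rwa [SimpleGraph.Subgraph.edgeSet_spanningCoe]⟩
  · rintro ⟨K, hK, hS, hl⟩
    exact ⟨_, hS.isSteinerForest hK, (edgeSet_toSubgraph hK).symm ▸ hl⟩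

namespace RAM.Memory

variable {A : Memory}

theorem HasClasses.connects_map_iff {n : ℕ} {S : Set (Fin n × Fin n)}
    (hA : A.HasClasses fun u v => (u, v) ∈ S) {K : SimpleGraph (Fin n)} :
    A.partitionedGraph.Connects (K.map Fin.valEmbedding) ↔ ConnectsPairs S K := by
  constructor
  · intro h p hp
    have hmem (u : Fin n) : (u : ℕ) ∈ A.partitionedGraph.verts :=
      Finset.mem_range.2 (u.2.trans_eq hA.order_eq.symm)
    exact reachable_map_iff.1 (h _ (hmem p.1) _ (hmem p.2) ((hA.cls_eq_iff _ _).2 (.rel _ _ hp)))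
  · intro h u hu v hv huv
    have hn {u : ℕ} (hu : u ∈ A.partitionedGraph.verts) : u < n :=
      (Finset.mem_range.1 hu).trans_eq hA.order_eq
    exact reachable_map_iff (f := Fin.valEmbedding).2 (h.reachable_of_eqvGen
      ((hA.cls_eq_iff ⟨u, hn hu⟩ ⟨v, hn hv⟩).1 huv))

theorem Represents.hasForest_iff {I : SteinerInstance} (hA : A.Represents I) {l : ℕ} :
    A.HasForest l ↔ I.HasSteinerForestOfSize l := by
  rw [HasForest, SteinerInstance.hasSteinerForestOfSize_iff, hA.graph_eq]
  constructor
  · rintro ⟨H, hH, hcon, hl⟩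
    obtain ⟨K, hK, rfl⟩ := exists_map_eq_of_le_map hH
    exact ⟨K, hK, hA.hasClasses.connects_map_iff.1 hcon, ncard_edgeSet_map.symm.trans_le hl⟩
  · rintro ⟨K, hK, hS, hl⟩
    exact ⟨_, SimpleGraph.map_monotone _ hK, hA.hasClasses.connects_map_iff.2 hS,
      ncard_edgeSet_map.trans_le hl⟩

theorem HasForest.order {l : ℕ} (h : A.HasForest l) : A.HasForest A.order := by
  obtain ⟨H, hH, hcon, -⟩ := h
  obtain ⟨root, hroot, hreach, -⟩ := exists_root_mem H ∅
  have hlt : {x | root x ≠ x} ⊆ Finset.range A.order := fun x hx => by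
    obtain ⟨y, hxy, -⟩ := exists_adj_dist_lt (hreach x) (Ne.symm hx)
    exact Finset.mem_coe.2 (Finset.mem_range.2 (hH hxy).2.1.1)
  obtain ⟨F, hF, hcard, hFroot⟩ :=
    exists_spanning_forest hroot hreach (Set.Finite.subset (Finset.finite_toSet _) hlt)
  refine ⟨F, hF.trans hH, fun u hu v hv huv => ?_, hcard.trans ?_⟩
  · have heq := eq_of_reachable_of_adj hroot (hcon u hu v hv huv)
    exact (hFroot u).trans (heq ▸ (hFroot v).symm)
  · simpa using Set.ncard_le_ncard hlt (Finset.finite_toSet _)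

end RAM.Memory

/-! ### Computing an optimal forest -/

theorem card_filter_not_le_iff {P : ℕ → Prop} [DecidablePred P] (hP : Monotone P) {n : ℕ} (hn : P n)
    {l : ℕ} : ((Finset.range n).filter fun c => ¬ P c).card ≤ l ↔ P l := by
  have hex : ∃ c, P c := ⟨n, hn⟩
  have hiff (c : ℕ) : P c ↔ Nat.find hex ≤ c :=
    ⟨Nat.find_min' hex, fun h => hP h (Nat.find_spec hex)⟩
  have hfilter : ((Finset.range n).filter fun c => ¬ P c) = Finset.range (Nat.find hex) := by
    ext c
    have := (hiff n).1 hn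
    simp only [Finset.mem_filter, Finset.mem_range, hiff]
    lia
  rw [hfilter, Finset.card_range, hiff]

theorem mul_add_eq_mul_add_iff {n u v x y : ℕ} (hv : v < n) (hy : y < n) :
    n * u + v = n * x + y ↔ u = x ∧ v = y := by
  refine ⟨fun h => ?_, fun ⟨hu, hv⟩ => hu ▸ hv ▸ rfl⟩
  obtain rfl : v = y := by
    rw [← Nat.mod_eq_of_lt hv, ← Nat.mul_add_mod n u v, h, Nat.mul_add_mod, Nat.mod_eq_of_lt hy]
  exact ⟨Nat.eq_of_mul_eq_mul_left (Nat.zero_lt_of_lt hv) (Nat.add_right_cancel h), rfl⟩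

namespace RAM.Memory

variable {A B : Memory} {l u v : ℕ}

theorem HasForest.mono {l' : ℕ} (h : A.HasForest l) (hl : l ≤ l') : A.HasForest l' := by
  obtain ⟨H, hH, hcon, hcard⟩ := h
  exact ⟨H, hH, hcon, hcard.trans hl⟩

open Classical in
/-- The minimum number of edges of a forest, provided that there is one. -/
noncomputable def optimum (A : Memory) : ℕ :=
  ((Finset.range A.order).filter fun l => ¬ A.HasPlanCodes l).card

theorem HasPlaceValues.optimum_le_iff (hA : A.HasPlaceValues) (hD : A.partitionedGraph.IsProper)
    (h : A.HasForest A.order) : A.optimum ≤ l ↔ A.HasForest l := by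
  classical
  simp only [optimum, hA.hasPlanCodes_iff hD]
  exact card_filter_not_le_iff (fun _ _ hl h => h.mono hl) h

/-- The edge with ends `u` and `v` is deleted. -/
def deleteEdge (u v : ℕ) (A : Memory) : Memory := A.set 0 (A.edgeCell u v) 0

/-- The edge with ends `u` and `v` is restored after its deletion. -/
def restoreEdge (u v : ℕ) (A : Memory) : Memory := A.set 0 (A.edgeCell u v) 1

open Classical in
/-- The edge with ends `u` and `v` is deleted, if this leaves a forest whose number of edges is at
most the number in array `10`. -/
noncomputable def tryDeleteEdge (u v : ℕ) (A : Memory) : Memory :=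
  if A.graph.Adj u v then
    if (A.deleteEdge u v).HasPlanCodes (A.deleteEdge u v 10 0) then A.deleteEdge u v
    else (A.deleteEdge u v).restoreEdge u v
  else A

/-- Edges are deleted as long as there remains a forest whose number of edges is at most the number
in array `10`. -/
noncomputable def deleteEdges (A : Memory) : Memory := forPairs tryDeleteEdge A

theorem eqOn_deleteEdge : ({0}ᶜ : Set ℕ).EqOn (A.deleteEdge u v) A := eqOn_set (by simp)

theorem eqOn_tryDeleteEdge : ({0}ᶜ : Set ℕ).EqOn (A.tryDeleteEdge u v) A := by
  rw [tryDeleteEdge]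
  split_ifs
  exacts [eqOn_deleteEdge, (eqOn_set (by simp)).trans eqOn_deleteEdge, fun _ _ => rfl]

theorem eqOn_deleteEdges : ({0}ᶜ : Set ℕ).EqOn A.deleteEdges A :=
  eqOn_forPairs fun _ _ _ => eqOn_tryDeleteEdge

theorem adj_deleteEdge {x y : ℕ} (hv : v < A.order) :
    (A.deleteEdge u v).graph.Adj x y ↔ A.graph.Adj x y ∧ s(x, y) ≠ s(u, v) := by
  have hcell {x y : ℕ} (hy : y < A.order) : A.deleteEdge u v 0 (A.edgeCell x y) ≠ 0 ↔
      A 0 (A.edgeCell x y) ≠ 0 ∧ ¬ (x = u ∧ y = v) := by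
    rw [deleteEdge, set_apply, ← mul_add_eq_mul_add_iff hy hv]
    simp only [edgeCell, true_and, Nat.add_left_cancel_iff]
    split_ifs with h <;> simp [h]
  rw [ne_eq, Sym2.eq_iff]
  constructor
  · rintro ⟨hne, hlt, h, h'⟩
    have := (hcell hlt.2).1 h
    have := (hcell hlt.1).1 h'
    exact ⟨⟨hne, hlt, by tauto⟩, by tauto⟩
  · rintro ⟨⟨hne, hlt, h, h'⟩, hs⟩
    exact ⟨hne, hlt, (hcell hlt.2).2 ⟨h, by tauto⟩, (hcell hlt.1).2 ⟨h', by tauto⟩⟩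

theorem le_graph_deleteEdge_iff {H : SimpleGraph ℕ} (hv : v < A.order) :
    H ≤ (A.deleteEdge u v).graph ↔ H ≤ A.graph ∧ ¬ H.Adj u v := by
  constructor
  · exact fun h => ⟨fun x y hxy => ((adj_deleteEdge hv).1 (h hxy)).1,
      fun huv => ((adj_deleteEdge hv).1 (h huv)).2 rfl⟩
  · rintro ⟨h, huv⟩ x y hxy
    refine (adj_deleteEdge hv).2 ⟨h hxy, fun heq => huv ?_⟩
    exact (H.mem_edgeSet).1 (heq ▸ (H.mem_edgeSet).2 hxy)

theorem graph_restoreEdge_deleteEdge (h : A.graph.Adj u v) :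
    ((A.deleteEdge u v).restoreEdge u v).graph = A.graph := by
  have hcell : (A.deleteEdge u v).edgeCell u v = A.edgeCell u v := rfl
  have hne (i : ℕ) : (A.deleteEdge u v).restoreEdge u v 0 i ≠ 0 ↔ A 0 i ≠ 0 := by
    rw [restoreEdge, hcell, deleteEdge, set_apply, set_apply]
    split_ifs with hi
    · simpa [hi.2] using h.2.2.1
    · rfl
  ext x y
  exact and_congr_right' (and_congr_right' (and_congr (hne _) (hne _)))

theorem connects_congr {H : SimpleGraph ℕ} (h2 : B 2 = A 2) (h6 : B 6 = A 6) :
    B.partitionedGraph.Connects H ↔ A.partitionedGraph.Connects H := by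
  simp only [PartitionedGraph.Connects, partitionedGraph, order, h2, h6]

theorem HasPlaceValues.hasPlanCodes_iff_of_graph_le (hA : A.HasPlaceValues)
    (hD : A.partitionedGraph.IsProper) (hB : ({0}ᶜ : Set ℕ).EqOn B A) (hle : B.graph ≤ A.graph) :
    B.HasPlanCodes l ↔
      ∃ H ≤ B.graph, A.partitionedGraph.Connects H ∧ H.edgeSet.ncard ≤ l := by
  have horder : B.order = A.order := congrFun (hB (by simp)) 0
  have hcover : B.cover = A.cover := cover_congr (hB (by simp)) (hB (by simp))
  have hproper : B.partitionedGraph.IsProper := by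
    simp only [partitionedGraph, horder, hcover, hB (show 6 ∈ _ by simp)]
    exact ⟨fun h => hD.mem_verts (hle h), fun h => hD.mem_cover (hle h), hD.cover_subset,
      hD.cls_mem⟩
  rw [(hA.congr (hB (by simp)) (hB (by simp)) (hB (by simp)) (hB (by simp))).hasPlanCodes_iff
    hproper, HasForest]
  simp only [connects_congr (hB (show 2 ∈ _ by simp)) (hB (show 6 ∈ _ by simp))]

/-- All pairs in `T` that are edges of `B` belong to every forest with at most `l` edges that
remains in `B`, and there is such a forest. -/
structure IsReduced (A : Memory) (l : ℕ) (T : Set (ℕ × ℕ)) (B : Memory) : Prop where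
  eqOn : ({0}ᶜ : Set ℕ).EqOn B A
  graph_le : B.graph ≤ A.graph
  exists_forest : ∃ H ≤ B.graph, A.partitionedGraph.Connects H ∧ H.edgeSet.ncard ≤ l
  adj_of_mem : ∀ p ∈ T, B.graph.Adj p.1 p.2 → ∀ H ≤ B.graph, A.partitionedGraph.Connects H →
    H.edgeSet.ncard ≤ l → H.Adj p.1 p.2

theorem IsReduced.tryDeleteEdge {T : Set (ℕ × ℕ)} (hA : A.HasPlaceValues)
    (hD : A.partitionedGraph.IsProper) (hB : A.IsReduced (A 10 0) T B) (hv : v < B.order) :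
    A.IsReduced (A 10 0) (insert (u, v) T) (B.tryDeleteEdge u v) := by
  have hten : B.deleteEdge u v 10 0 = A 10 0 := congrFun (hB.eqOn (by simp)) 0
  have hle : (B.deleteEdge u v).graph ≤ B.graph := ((le_graph_deleteEdge_iff hv).1 le_rfl).1
  have hplan := hA.hasPlanCodes_iff_of_graph_le (l := A 10 0) hD
    (eqOn_deleteEdge.trans hB.eqOn) (hle.trans hB.graph_le)
  refine ⟨eqOn_tryDeleteEdge.trans hB.eqOn, ?_, ?_, ?_⟩ <;>
    (rw [Memory.tryDeleteEdge, hten]; split_ifs with hadj hforest)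
  · exact hle.trans hB.graph_le
  · exact (graph_restoreEdge_deleteEdge hadj).trans_le hB.graph_le
  · exact hB.graph_le
  · exact hplan.1 hforest
  · exact graph_restoreEdge_deleteEdge hadj ▸ hB.exists_forest
  · exact hB.exists_forest
  · rintro p (rfl | hp) hp' H hH
    · exact absurd rfl ((adj_deleteEdge hv).1 hp').2
    · exact hB.adj_of_mem p hp (hle hp') H (hH.trans hle)
  · rw [graph_restoreEdge_deleteEdge hadj]
    rintro p (rfl | hp) hp' H hH hcon hcard
    · by_contra hnot
      exact hforest (hplan.2 ⟨H, (le_graph_deleteEdge_iff hv).2 ⟨hH, hnot⟩, hcon, hcard⟩)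
    · exact hB.adj_of_mem p hp hp' H hH hcon hcard
  · rintro p (rfl | hp) hp'
    exacts [absurd hp' hadj, hB.adj_of_mem p hp hp']

theorem HasPlaceValues.connects_graph_deleteEdges (hA : A.HasPlaceValues)
    (hD : A.partitionedGraph.IsProper) (h : A.HasForest (A 10 0)) :
    A.deleteEdges.graph ≤ A.graph ∧ A.partitionedGraph.Connects A.deleteEdges.graph ∧
      A.deleteEdges.graph.edgeSet.ncard ≤ A 10 0 := by
  have hred := forPairs_induction (A.IsReduced (A 10 0))
    (fun T B hB => congrFun (hB.eqOn (by simp)) 0) ⟨fun _ _ => rfl, le_rfl, h, by simp⟩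
    fun _ _ v hv T B hB => hB.tryDeleteEdge hA hD
      (hv.trans_eq (congrFun (hB.eqOn (by simp)) 0).symm)
  obtain ⟨H, hH, hcon, hcard⟩ := hred.exists_forest
  obtain rfl : H = A.deleteEdges.graph := hH.antisymm fun x y hxy =>
    hred.adj_of_mem (x, y) (hred.graph_le hxy).2.1 hxy H hH hcon hcard
  exact ⟨hred.graph_le, hcon, hcard⟩

/-- The output is the single number `b`. -/
def answer (b : ℕ) (A : Memory) : Memory := (A.set 1 0 b).set 9 0 1

theorem output_answer {b : ℕ} : (A.answer b).output = [b] := rfl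

open Classical in
/-- The adjacency matrix is written to array `1`, from cell `1` on. -/
noncomputable def writeEdges (A : Memory) : Memory :=
  forPairs (fun i j B => B.set 1 (1 + (B.order * i + j)) (if B.graph.Adj i j then 1 else 0)) A

/-- The output is `1`, followed by the adjacency matrix. -/
noncomputable def writeMatrix (A : Memory) : Memory :=
  (A.set 9 0 (A.order * A.order + 1)).writeEdges.set 1 0 1

theorem eqOn_writeEdges : ({1}ᶜ : Set ℕ).EqOn A.writeEdges A :=
  eqOn_forPairs fun _ _ _ => eqOn_set (by simp)

open Classical in
theorem writeEdges_apply (hu : u < A.order) (hv : v < A.order) :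
    A.writeEdges 1 (1 + (A.order * u + v)) = if A.graph.Adj u v then 1 else 0 := by
  refine (forPairs_induction (fun T B => ({1}ᶜ : Set ℕ).EqOn B A ∧ ∀ p ∈ T, p.2 < A.order →
    B 1 (1 + (A.order * p.1 + p.2)) = if A.graph.Adj p.1 p.2 then 1 else 0)
    (fun T B h => congrFun (h.1 (by simp)) 0) ⟨fun _ _ => rfl, by simp⟩
    fun i _ j hj T B ⟨hB, hT⟩ => ⟨(eqOn_set (by simp)).trans hB, ?_⟩).2 (u, v) ⟨hu, hv⟩ hv
  have hgraph : B.graph = A.graph := graph_congr (hB (by simp)) (hB (by simp)) (hB (by simp))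
  have horder : B.order = A.order := congrFun (hB (by simp)) 0
  rintro p (rfl | hp) hlt
  · simp [set_apply, hgraph, horder]
  simp only [set_apply, hgraph, horder, Nat.add_left_cancel_iff, mul_add_eq_mul_add_iff hlt hj,
    hT p hp hlt, true_and]
  split_ifs <;> grind

theorem output_writeMatrix {n : ℕ} {K : SimpleGraph (Fin n)} (hn : A.order = n)
    (hK : A.graph = K.map Fin.valEmbedding) : A.writeMatrix.output = 1 :: matrixBits K.Adj := by
  classical
  subst hn
  have hlen : A.writeMatrix 9 0 = A.order * A.order + 1 :=
    (congrFun (eqOn_set (X := {1}ᶜ) (by simp) (by simp)) 0).trans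
      (congrFun (eqOn_writeEdges (by simp)) 0)
  rw [output, matrixBits_eq_ofFn, hlen]
  refine List.ext_getElem (by simp) fun k hk _ => ?_
  cases k with
  | zero => simp [writeMatrix, set_apply]
  | succ k =>
    have hlt : k < A.order * A.order := by simpa using hk
    obtain ⟨⟨i, j⟩, hij⟩ := finProdFinEquiv.surjective (⟨k, hlt⟩ : Fin (A.order * A.order))
    have hk' : k + 1 = 1 + (A.order * i + j) := by
      have hval := congrArg Fin.val hij
      rw [finProdFinEquiv_apply_val] at hval
      lia
    have hadj : A.graph.Adj i j ↔ K.Adj i j :=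
      hK ▸ SimpleGraph.map_adj_apply (f := Fin.valEmbedding)
    simp only [List.getElem_map, List.getElem_range, List.getElem_cons_succ, List.getElem_ofFn,
      ← hij, Equiv.symm_apply_apply]
    rw [writeMatrix, set_apply, if_neg (by simp), hk']
    refine (writeEdges_apply (A := A.set 9 0 (A.order * A.order + 1)) i.2 j.2).trans ?_
    simp only [← hadj]
    rfl

end RAM.Memory

namespace RAM

namespace Memory

open Classical in
/-- The output tells whether there is a forest whose number of edges is at most the first number of
the input. -/
noncomputable def decide (A : Memory) : Memory := A.answer (if A.HasPlanCodes (A 0 0) then 1 else 0)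

/-- The minimum number of edges of a forest is stored in array `10`. -/
noncomputable def storeOptimum (A : Memory) : Memory := A.set 10 0 A.optimum

open Classical in
/-- The output is an optimal forest, or `0` if there is none. -/
noncomputable def solve (A : Memory) : Memory :=
  if A.HasPlanCodes A.order then A.storeOptimum.deleteEdges.writeMatrix else A.answer 0

end Memory

namespace PolyTimeMap

variable {V : Type} [VarTuple V]

theorem answer {f : V → Memory → ℕ} (hf : PolyTime f) :
    PolyTimeMap fun v A => A.answer (f v A) :=
  .comp (G := fun _ A => A.set 9 0 1) (.set 9 (.const 0) (.const 1)) (.set 1 (.const 0) hf)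

theorem deleteEdge : PolyTimeMap fun (v : (V × ℕ) × ℕ) A => A.deleteEdge v.1.2 v.2 :=
  .set 0 (.edgeCell (.weaken .last) .last) (.const 0)

theorem restoreEdge : PolyTimeMap fun (v : (V × ℕ) × ℕ) A => A.restoreEdge v.1.2 v.2 :=
  .set 0 (.edgeCell (.weaken .last) .last) (.const 1)

open Classical in
theorem tryDeleteEdge : PolyTimeMap fun (v : (V × ℕ) × ℕ) A => A.tryDeleteEdge v.1.2 v.2 := by
  have hundo : PolyTimeMap fun (v : (V × ℕ) × ℕ) A =>
      if A.HasPlanCodes (A 10 0) then A else A.restoreEdge v.1.2 v.2 :=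
    .ite (.hasPlanCodes (.read 10 (.const 0))) .id restoreEdge
  exact .ite (.adj (.weaken .last) .last) (hundo.comp deleteEdge) .id

theorem deleteEdges : PolyTimeMap fun (_ : V) A => A.deleteEdges := .forPairs tryDeleteEdge

open Classical in
theorem writeEdges : PolyTimeMap fun (_ : V) A => A.writeEdges :=
  .forPairs <| .set 1 (.add (.const 1) (.add (.mul .order (.weaken .last)) .last)) <|
    .ite (.adj (.weaken .last) .last) (.const 1) (.const 0)

theorem writeMatrix : PolyTimeMap fun (_ : V) A => A.writeMatrix :=
  .comp (G := fun _ A => A.set 1 0 1) (.set 1 (.const 0) (.const 1)) <|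
    .comp writeEdges <| .set 9 (.const 0) <| .add (.mul .order .order) (.const 1)

open Classical in
theorem storeOptimum : PolyTimeMap fun (_ : V) A => A.storeOptimum :=
  .set 10 (.const 0) (.card_filter .order (.not (.hasPlanCodes .last)))

open Classical in
theorem decide : PolyTimeMap fun (_ : V) A => A.decide :=
  answer (.ite (.hasPlanCodes (.read 0 (.const 0))) (.const 1) (.const 0))

open Classical in
theorem solve : PolyTimeMap fun (_ : V) A => A.solve :=
  .ite (.hasPlanCodes .order) (writeMatrix.comp (deleteEdges.comp storeOptimum)) (answer (.const 0))

end PolyTimeMap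
namespace Memory

variable {A : Memory} {I : SteinerInstance} {l : ℕ}

theorem Represents.hasPlanCodes_iff (hA : A.Represents I) :
    A.HasPlanCodes l ↔ I.HasSteinerForestOfSize l :=
  (hA.hasPlaceValues.hasPlanCodes_iff hA.isProper l).trans hA.hasForest_iff

theorem Represents.hasForest_order (hA : A.Represents I) (h : I.Feasible) :
    A.HasForest A.order := by
  obtain ⟨F, hF⟩ := h
  exact (hA.hasForest_iff.2 ⟨F, hF, le_rfl⟩).order

theorem Represents.hasPlanCodes_order_iff (hA : A.Represents I) :
    A.HasPlanCodes A.order ↔ I.Feasible :=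
  ⟨fun h => (hA.hasPlanCodes_iff.1 h).imp fun _ hF => hF.1,
    fun h => (hA.hasPlaceValues.hasPlanCodes_iff hA.isProper _).2 (hA.hasForest_order h)⟩

theorem Represents.storeOptimum (hA : A.Represents I) : A.storeOptimum.Represents I := by
  have hB : ({10}ᶜ : Set ℕ).EqOn A.storeOptimum A := eqOn_set (by simp)
  have hgraph : A.storeOptimum.graph = A.graph :=
    graph_congr (hB (by simp)) (hB (by simp)) (hB (by simp))
  have hcover : A.storeOptimum.cover = A.cover := cover_congr (hB (by simp)) (hB (by simp))
  exact ⟨hgraph.trans hA.graph_eq, hA.hasClasses.congr (hB (by simp)) (hB (by simp)),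
    fun h => hcover ▸ hA.mem_cover (hgraph ▸ h), hcover ▸ hA.card_cover_le,
    hA.hasPlaceValues.congr (hB (by simp)) (hB (by simp)) (hB (by simp)) (hB (by simp))⟩

theorem Represents.exists_isMinSteinerForest (hA : A.Represents I)
    (hmin : ∀ l, A 10 0 ≤ l ↔ I.HasSteinerForestOfSize l) :
    ∃ F : I.G.Subgraph, IsMinSteinerForest I.S F ∧
      A.deleteEdges.writeMatrix.output = 1 :: matrixBits F.Adj := by
  obtain ⟨hle, hcon, hcard⟩ := hA.hasPlaceValues.connects_graph_deleteEdges hA.isProper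
    (hA.hasForest_iff.2 ((hmin _).1 le_rfl))
  obtain ⟨K, hK, hmap⟩ := exists_map_eq_of_le_map (hle.trans_eq hA.graph_eq)
  rw [← hmap] at hcon hcard
  have hforest : IsSteinerForest I.S (SimpleGraph.toSubgraph K hK) :=
    (hA.hasClasses.connects_map_iff.1 hcon).isSteinerForest hK
  refine ⟨_, ⟨hforest, fun F' hF' => ?_⟩, output_writeMatrix ?_ hmap.symm⟩
  · rw [edgeSet_toSubgraph]
    exact (ncard_edgeSet_map.symm.trans_le hcard).trans ((hmin _).2 ⟨F', hF', le_rfl⟩)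
  · exact (congrFun (eqOn_deleteEdges (by simp)) 0).trans hA.hasClasses.order_eq

open Classical in
theorem Represents.output_decide (hA : A.Represents I) :
    A.decide.output = [if I.HasSteinerForestOfSize (A 0 0) then 1 else 0] := by
  simp only [Memory.decide, output_answer, hA.hasPlanCodes_iff]

theorem Represents.output_solve_of_feasible (hA : A.Represents I) (h : I.Feasible) :
    ∃ F : I.G.Subgraph, IsMinSteinerForest I.S F ∧ A.solve.output = 1 :: matrixBits F.Adj := by
  rw [solve, if_pos (hA.hasPlanCodes_order_iff.2 h)]
  exact hA.storeOptimum.exists_isMinSteinerForest fun l =>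
    (hA.hasPlaceValues.optimum_le_iff hA.isProper (hA.hasForest_order h)).trans hA.hasForest_iff

theorem Represents.output_solve_of_not_feasible (hA : A.Represents I) (h : ¬ I.Feasible) :
    A.solve.output = [0] := by
  rw [solve, if_neg (hA.hasPlanCodes_order_iff.not.2 h), output_answer]

end Memory

end RAM

/-! ### Running times -/

theorem two_rpow_mul_logb (κ c : ℕ) :
    (2 : ℝ) ^ (c * (κ * Real.logb 2 κ)) = (((κ ^ κ) ^ c : ℕ) : ℝ) := by
  have h : (2 : ℝ) ^ (κ * Real.logb 2 κ) = ((κ ^ κ : ℕ) : ℝ) := by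
    rcases Nat.eq_zero_or_pos κ with rfl | hκ
    · simp
    · rw [mul_comm, Real.rpow_mul (by norm_num), Real.rpow_logb (by norm_num) (by norm_num)
        (by exact_mod_cast hκ), Real.rpow_natCast, Nat.cast_pow]
  rw [mul_comm, Real.rpow_mul (by norm_num), h, Real.rpow_natCast, ← Nat.cast_pow]

theorem succ_pow_self_le {m κ : ℕ} (h : m ≤ 2 * κ) : (m + 1) ^ m ≤ 9 * (κ ^ κ) ^ 6 := by
  calc (m + 1) ^ m ≤ (2 * κ + 1) ^ (2 * κ) := by gcongr; lia
    _ ≤ 9 * (κ ^ κ) ^ 6 := ?_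
  rcases Nat.lt_or_ge κ 2 with hκ | hκ
  · interval_cases κ <;> norm_num
  · have hbase : 2 * κ + 1 ≤ κ ^ 3 := by nlinarith [Nat.mul_le_mul hκ hκ]
    calc (2 * κ + 1) ^ (2 * κ) ≤ (κ ^ 3) ^ (2 * κ) := by gcongr
      _ = (κ ^ κ) ^ 6 := by ring
      _ ≤ 9 * (κ ^ κ) ^ 6 := Nat.le_mul_of_pos_left _ (by norm_num)

/-- The bound `2 ^ O(k log k) * n ^ O(1)` with `c` in the place of the implied constants. -/
noncomputable abbrev SteinerInstance.timeBound (I : SteinerInstance) (c : ℕ) : ℝ :=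
  c * (2 : ℝ) ^ (c * (I.vc * Real.logb 2 I.vc)) * ((I.n : ℝ) + 1) ^ c

theorem SteinerInstance.timeBound_eq (I : SteinerInstance) (c : ℕ) :
    I.timeBound c = ((c * (I.vc ^ I.vc) ^ c * (I.n + 1) ^ c : ℕ) : ℝ) := by
  rw [timeBound, two_rpow_mul_logb]
  push_cast
  rfl

namespace RAM

theorem Memory.Represents.size_succ_le {A : Memory} {I : SteinerInstance} (hA : A.Represents I) :
    A.size + 1 ≤ 10 * (I.vc ^ I.vc) ^ 6 * (I.n + 1) := by
  have hcodes := hA.hasPlaceValues.numCodes_eq.trans_le (succ_pow_self_le hA.card_cover_le)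
  have hpos : 0 < (I.vc ^ I.vc) ^ 6 := Nat.pow_pos Nat.pow_self_pos
  rw [Memory.size, hA.hasClasses.order_eq]
  nlinarith

theorem Memory.Represents.time_le {A : Memory} {I : SteinerInstance} (hA : A.Represents I) (k : ℕ) :
    ((k * (A.size + 1) ^ k : ℕ) : ℝ) ≤ I.timeBound (k * 10 ^ k + 6 * k) := by
  set c := k * 10 ^ k + 6 * k
  rw [I.timeBound_eq]
  have hpos : 0 < I.vc ^ I.vc := Nat.pow_self_pos
  refine Nat.cast_le.2 ?_
  calc k * (A.size + 1) ^ k ≤ k * (10 * (I.vc ^ I.vc) ^ 6 * (I.n + 1)) ^ k := by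
        gcongr
        exact hA.size_succ_le
    _ = k * 10 ^ k * (I.vc ^ I.vc) ^ (6 * k) * (I.n + 1) ^ k := by
        rw [mul_pow, mul_pow, ← pow_mul, mul_assoc k, mul_assoc k]
    _ ≤ c * (I.vc ^ I.vc) ^ c * (I.n + 1) ^ c := by gcongr <;> lia

theorem exists_outputsWithin {G : Memory → Memory} (p : ℕ)
    (hG : PolyTimeMap fun (_ : Unit) => G) :
    ∃ (c : ℕ) (P : Prog), ∀ (pre : List ℕ) (I : SteinerInstance), pre.length = p →
      ∃ A : Memory, A.Represents I ∧ A 0 0 = (pre ++ I.encode).getD 0 0 ∧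
        P.OutputsWithin (pre ++ I.encode) (G A).output (I.timeBound c) := by
  obtain ⟨P, k, hP⟩ := exists_prog p hG
  refine ⟨k * 10 ^ k + 6 * k, P, fun pre I hp => ?_⟩
  subst hp
  have hA := Memory.represents_load pre I
  obtain ⟨s, t, hexec, ht, hout⟩ := hP (pre ++ I.encode)
  exact ⟨_, hA, congrFun (Memory.eqOn_loadNumCodes_prepare (by simp)) 0,
    s, t, hexec, hout, (Nat.cast_le.2 ht).trans (hA.time_le k)⟩

theorem exists_decidesWithin : ∃ (c : ℕ) (P : Prog), ∀ (I : SteinerInstance) (l : ℕ),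
    P.DecidesWithin (I.encodeWith l) (I.HasSteinerForestOfSize l) (I.timeBound c) := by
  obtain ⟨c, P, hP⟩ := exists_outputsWithin 1 .decide
  refine ⟨c, P, fun I l => ?_⟩
  obtain ⟨A, hA, hl, hout⟩ := hP [l] I rfl
  rwa [hA.output_decide, hl] at hout

theorem exists_solver : ∃ (c : ℕ) (P : Prog), ∀ I : SteinerInstance,
    (I.Feasible → ∃ F : I.G.Subgraph, IsMinSteinerForest I.S F ∧
      P.OutputsWithin I.encode (1 :: matrixBits F.Adj) (I.timeBound c)) ∧
    (¬ I.Feasible → P.OutputsWithin I.encode [0] (I.timeBound c)) := by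
  obtain ⟨c, P, hP⟩ := exists_outputsWithin 0 .solve
  refine ⟨c, P, fun I => ?_⟩
  obtain ⟨A, hA, -, hout⟩ := hP [] I rfl
  refine ⟨fun h => ?_, fun h => hA.output_solve_of_not_feasible h ▸ hout⟩
  obtain ⟨F, hF, heq⟩ := hA.output_solve_of_feasible h
  exact ⟨F, hF, heq ▸ hout⟩

theorem primrec₂_pow : Primrec₂ fun a b : ℕ => a ^ b := by
  have h : Primrec₂ fun a b : ℕ => (Nat.rec 1 (fun _ r => r * a) b : ℕ) :=
    Primrec.nat_rec (Primrec.const 1)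
      (Primrec.nat_mul.comp (Primrec.snd.comp Primrec.snd) Primrec.fst).to₂
  refine h.of_eq fun a b => ?_
  induction b with
  | zero => rfl
  | succ b ih => rw [pow_succ, ← ih]

theorem length_le_inputSize (x : List ℕ) : x.length ≤ inputSize x := by
  induction x with
  | nil => exact Nat.zero_le _
  | cons a x ih =>
    simp only [inputSize, List.map_cons, List.sum_cons, List.length_cons] at ih ⊢
    lia

theorem succ_le_inputSize_encodeWith (I : SteinerInstance) (l : ℕ) :
    I.n + 1 ≤ inputSize (I.encodeWith l) := by
  refine le_trans ?_ (length_le_inputSize _)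
  simp only [SteinerInstance.encodeWith, SteinerInstance.encode, List.length_cons,
    List.length_append, length_matrixBits]
  nlinarith

theorem fixedParameterTractable : FixedParameterTractable
    (fun a : SteinerInstance × ℕ => a.1.encodeWith a.2)
    (fun a => a.1.HasSteinerForestOfSize a.2) (fun a => a.1.vc) := by
  obtain ⟨c, P, hP⟩ := exists_decidesWithin
  refine ⟨fun κ => c * (κ ^ κ) ^ c, c, P, ?_, fun ⟨I, l⟩ => ?_⟩
  · exact (Primrec.nat_mul.comp (.const c)
      (primrec₂_pow.comp (primrec₂_pow.comp .id .id) (.const c))).to_comp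
  · obtain ⟨s, t, hexec, hout, ht⟩ := hP I l
    refine ⟨s, t, hexec, hout, ht.trans ?_⟩
    rw [I.timeBound_eq, ← Nat.cast_pow, ← Nat.cast_mul, Nat.cast_le]
    gcongr
    exact succ_le_inputSize_encodeWith I l

end RAM

/-- (1) Steiner Forest is fixed-parameter tractable by the vertex cover number `k`; (2) it is decided
in time `2 ^ O(k log k) * n ^ O(1)`, where `n` is the number of vertices; (3) within the same time
one can compute (the adjacency matrix of) a Steiner forest with the minimum number of edges, or report
that there is none. -/
theorem theorem9 :
    RAM.FixedParameterTractable
      (fun a : SteinerInstance × ℕ => a.1.encodeWith a.2)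
      (fun a => a.1.HasSteinerForestOfSize a.2)
      (fun a => a.1.vc) ∧
    (∃ (c : ℕ) (P : RAM.Prog), ∀ (I : SteinerInstance) (l : ℕ),
      P.DecidesWithin (I.encodeWith l) (I.HasSteinerForestOfSize l)
        (c * (2 : ℝ) ^ (c * (I.vc * Real.logb 2 I.vc)) * ((I.n : ℝ) + 1) ^ c)) ∧
    (∃ (c : ℕ) (P : RAM.Prog), ∀ I : SteinerInstance,
      (I.Feasible → ∃ F : I.G.Subgraph, IsMinSteinerForest I.S F ∧
        P.OutputsWithin I.encode (1 :: matrixBits F.Adj)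
          (c * (2 : ℝ) ^ (c * (I.vc * Real.logb 2 I.vc)) * ((I.n : ℝ) + 1) ^ c)) ∧
      (¬ I.Feasible →
        P.OutputsWithin I.encode [0]
          (c * (2 : ℝ) ^ (c * (I.vc * Real.logb 2 I.vc)) * ((I.n : ℝ) + 1) ^ c))) := by
  exact ⟨RAM.fixedParameterTractable, RAM.exists_decidesWithin, RAM.exists_solver⟩
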